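/- **Conventions.** A *2-complex* is a 2-dimensional cell complex whose 1-skeleton is a directed graph and whose 2-cells are polygons with $n\ge 1$ sides attached along closed edge paths (of length $n$, not necessarily reduced). The *exponent sum* of an edge path is the number of edges traversed along their direction minus the number of edges traversed against it. A 2-complex is *standard* if it has exactly one vertex $v$. An edge is *free* if exactly one side of exactly one 2-cell is attached to it. A vertex is *free* if it is the endpoint of exactly one edge, is used by this edge only once, and this edge is not in the boundary of any 2-cell. A map of 2-complexes is *combinatorial* if it maps open cells homeomorphically to open cells, and a combinatorial map is an *immersion* if it is locally injective. The *essential part* of a 2-complex consists of all 2-cells together with the edges used in their attaching paths (and the vertices of these edges). A 2-complex $K$ has *collapsing non-positive immersion* if for every combinatorial immersion $X\to K$ with $X$ finite, connected and without free vertices or free edges, $\chi(X)\le 0$ or $X$ is a point. A pair $(L,K)$ of a 2-complex and a subcomplex has *relative collapsing non-positive immersion* if for every combinatorial immersion $f\colon X\to L$ with $X$ finite, connected and without free vertices or free edges, $\chi(X)\le\chi(Y)$ or $X$ is a point, where $Y$ is the essential part of $f^{-1}(K)$. The link $lk(v,L)$ of a vertex $v$ is the graph which has one vertex $e^+$ for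 each edge $e$ starting at $v$, one vertex $e^-$ for each edge $e$ ending at $v$, and one edge for each corner of a 2-cell at $v$. A *zero/one-angle structure* assigns to each corner $c$ an angle $\omega(c)\in\{0,1\}$. Then $lk_0(v,L)$ denotes the subgraph of $lk(v,L)$ consisting of all its vertices and the corners of angle $0$. The structure *satisfies the coloring test* if $\sum_{c}\omega(c)-(n-2)\le 0$ for every 2-cell with $n$ sides (sum over its corners), and $\sum_{i=1}^m\omega(c_i)\ge 2$ for every vertex $v$ and every reduced cycle $c_1\cdots c_m$ ($m\ge 1$) in $lk(v,L)$, that is, every closed path of oriented corners in which, cyclically, no corner is followed by its reverse. **Theorem.** Let $L$ be a standard 2-complex with vertex $v$, let $K\subseteq L$ be a subcomplex all of whose 2-cells are attached along paths of exponent sum zero, and let $y$ be an edge of $K$. Let $\bar L$ be obtained from $L$ by folding $K$ to the single edge $y$: $\bar L$ is the standard 2-complex whose edges are $y$ and the edges of $L$ not in $K$, and whose 2-cells are the 2-cells of $L$ not in $K$, attached along their attaching paths in $L$ with every edge of $K$ replaced by $y$ (respecting directions). Assume that $\bar L$ has a zero/one-angle structure that satisfies the coloring test and for which $y^+$ and $y^-$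 lie in different components of $lk_0(v,\bar L)$. Then $(L,K)$ has relative collapsing non-positive immersion. If in addition $K$ has collapsing non-positive immersion, then so does $L$. -/

import Mathlib

universe u

/-- A directed graph; loops and multiple edges are allowed. -/
structure DirGraph : Type (u + 1) where
  V : Type u
  E : Type u
  src : E → V
  tgt : E → V

namespace DirGraph

/-- An edge with a direction of travel. The dart `(e, true)` runs along `e`, the dart `(e, false)`
runs against it. A dart also stands for the point of its edge close to its initial vertex, so that
`(e, true)` is the point `e⁺` close to the start of `e` and `(e, false)` is the point `e⁻` close to
the end of `e`. -/
abbrev Dart (G : DirGraph.{u}) : Type u := G.E × Bool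

/-- The initial vertex of a dart. -/
def init (G : DirGraph.{u}) (d : G.Dart) : G.V := if d.2 = true then G.src d.1 else G.tgt d.1

/-- The reversed dart. -/
def rev (G : DirGraph.{u}) (d : G.Dart) : G.Dart := (d.1, !d.2)

/-- The terminal vertex of a dart. -/
def term (G : DirGraph.{u}) (d : G.Dart) : G.V := G.init (G.rev d)

/-- Any two vertices are joined by an edge path, and there is a vertex. -/
def IsConnected (G : DirGraph.{u}) : Prop :=
  Nonempty G.V ∧
    ∀ v w : G.V, Relation.EqvGen (fun a b => ∃ e : G.E, G.src e = a ∧ G.tgt e = b) v w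

end DirGraph

/-- A (combinatorial) 2-complex with directed edges: each 2-cell `f` is a polygon with
`len f ≥ 1` sides, attached along the closed edge path `side f 0, side f 1, …`. The path need not
be reduced. -/
structure TwoComplex : Type (u + 1) extends DirGraph.{u} where
  F : Type u
  len : F → ℕ
  len_ne : ∀ f, NeZero (len f)
  side : (f : F) → ZMod (len f) → E × Bool
  closed : ∀ f i, toDirGraph.term (side f i) = toDirGraph.init (side f (i + 1))

attribute [instance] TwoComplex.len_ne

namespace TwoComplex

/-- The corners of all 2-cells: `⟨f, i⟩` is the corner of the polygon `f` between its sides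
`i` and `i + 1`. -/
abbrev Corner (L : TwoComplex.{u}) : Type u := Σ f : L.F, ZMod (L.len f)

/-- The vertex at which a corner lies. -/
def cornerVertex (L : TwoComplex.{u}) (c : L.Corner) : L.V := L.init (L.side c.1 (c.2 + 1))

/-- First end of a corner. The link of a vertex `v` is the graph whose vertices are the darts
with initial vertex `v`, and whose edges are the corners at `v`; a corner joins
`cornerFst` to `cornerSnd`. -/
def cornerFst (L : TwoComplex.{u}) (c : L.Corner) : L.Dart := L.rev (L.side c.1 c.2)

/-- Second end of a corner. -/
def cornerSnd (L : TwoComplex.{u}) (c : L.Corner) : L.Dart := L.side c.1 (c.2 + 1)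

/-- A standard 2-complex has a single vertex. -/
def IsStandard (L : TwoComplex.{u}) : Prop := Nonempty L.V ∧ Subsingleton L.V

/-- Exponent sum of the attaching path of a 2-cell. -/
def expSum (L : TwoComplex.{u}) (f : L.F) : ℤ :=
  ∑ i : ZMod (L.len f), if (L.side f i).2 = true then 1 else -1

/-- Finitely many cells. -/
def IsFinite (X : TwoComplex.{u}) : Prop := Finite X.V ∧ Finite X.E ∧ Finite X.F

/-- The complex is a single point. -/
def IsPoint (X : TwoComplex.{u}) : Prop :=
  Nonempty X.V ∧ Subsingleton X.V ∧ IsEmpty X.E ∧ IsEmpty X.F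

/-- Euler characteristic (of a finite complex). -/
noncomputable def eulerChar (X : TwoComplex.{u}) : ℤ :=
  (Nat.card X.V : ℤ) - (Nat.card X.E : ℤ) + (Nat.card X.F : ℤ)

/-- An edge is free if exactly one side of exactly one 2-cell runs over it. -/
def IsFreeEdge (X : TwoComplex.{u}) (e : X.E) : Prop :=
  ∃! c : X.Corner, (X.side c.1 c.2).1 = e

/-- A vertex is free if it is used exactly once by exactly one edge, and this edge can be
collapsed from it, that is, no 2-cell runs over that edge. (The last requirement is automatic if
the 2-cells are attached along cyclically reduced paths: a 2-cell that runs over an edge with an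
end of valency one has to turn back there. Without it there would be no collapse, as the
2-sphere obtained by attaching a 2-cell to an arc `e` along `e e⁻¹` shows.) -/
def IsFreeVertex (X : TwoComplex.{u}) (v : X.V) : Prop :=
  ∃ d : X.Dart, (∀ d' : X.Dart, X.init d' = v ↔ d' = d) ∧
    ∀ c : X.Corner, (X.side c.1 c.2).1 ≠ d.1

/-! ### Subcomplexes -/

/-- A subcomplex. -/
structure Subcomplex (L : TwoComplex.{u}) : Type u where
  verts : Set L.V
  edges : Set L.E
  faces : Set L.F
  src_mem : ∀ e ∈ edges, L.src e ∈ verts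
  tgt_mem : ∀ e ∈ edges, L.tgt e ∈ verts
  side_mem : ∀ f ∈ faces, ∀ i, (L.side f i).1 ∈ edges

/-- A subcomplex as a 2-complex in its own right. -/
def Subcomplex.toComplex {L : TwoComplex.{u}} (K : L.Subcomplex) : TwoComplex.{u} where
  V := K.verts
  E := K.edges
  src e := ⟨L.src e, K.src_mem e e.2⟩
  tgt e := ⟨L.tgt e, K.tgt_mem e e.2⟩
  F := K.faces
  len f := L.len f
  len_ne f := L.len_ne f
  side f i := (⟨(L.side f i).1, K.side_mem f f.2 i⟩, (L.side f i).2)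
  closed f i := by
    have h := L.closed f i
    apply Subtype.ext
    simp only [DirGraph.term, DirGraph.init, DirGraph.rev] at h ⊢
    cases h1 : (L.side f i).2 <;> cases h2 : (L.side f (i + 1)).2 <;> simp_all

/-- The essential part of a subcomplex: all its 2-cells, together with the edges that are used in
their attaching paths (and the vertices of these edges). -/
def Subcomplex.essentialPart {X : TwoComplex.{u}} (S : X.Subcomplex) : X.Subcomplex where
  verts := {v | ∃ f ∈ S.faces, ∃ i, v = X.src (X.side f i).1 ∨ v = X.tgt (X.side f i).1}
  edges := {e | ∃ f ∈ S.faces, ∃ i, e = (X.side f i).1}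
  faces := S.faces
  src_mem := by
    rintro _ ⟨f, hf, i, rfl⟩
    exact ⟨f, hf, i, Or.inl rfl⟩
  tgt_mem := by
    rintro _ ⟨f, hf, i, rfl⟩
    exact ⟨f, hf, i, Or.inr rfl⟩
  side_mem := fun f hf i => ⟨f, hf, i, rfl⟩

/-! ### Combinatorial maps and immersions -/

/-- A combinatorial map: every open cell is mapped homeomorphically to an open cell. Edges may be
mapped with either orientation. On a 2-cell `f` the map is an isomorphism of polygons, a rotation
if `orient f = true` and a reflection otherwise. -/
structure CombMap (X L : TwoComplex.{u}) : Type u where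
  vert : X.V → L.V
  dart : X.Dart → L.Dart
  face : X.F → L.F
  orient : X.F → Bool
  sideMap : (f : X.F) → ZMod (X.len f) ≃ ZMod (L.len (face f))
  init_dart : ∀ d, L.init (dart d) = vert (X.init d)
  dart_rev : ∀ d, dart (X.rev d) = L.rev (dart d)
  sideMap_add_one : ∀ f i,
    sideMap f (i + 1) = if orient f = true then sideMap f i + 1 else sideMap f i - 1
  side_sideMap : ∀ f i, L.side (face f) (sideMap f i) =
    if orient f = true then dart (X.side f i) else L.rev (dart (X.side f i))

namespace CombMap

variable {X L : TwoComplex.{u}}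

/-- The induced map on corners. The corner between the sides `i` and `i + 1` goes to the corner
between their images. -/
def corner (φ : CombMap X L) (c : X.Corner) : L.Corner :=
  ⟨φ.face c.1, if φ.orient c.1 = true then φ.sideMap c.1 c.2 else φ.sideMap c.1 (c.2 + 1)⟩

/-- A combinatorial map is an immersion if it is locally injective, that is, injective on the
link of each vertex. -/
def IsImmersion (φ : CombMap X L) : Prop :=
  (∀ d d' : X.Dart, X.init d = X.init d' → φ.dart d = φ.dart d' → d = d') ∧
    ∀ c c' : X.Corner, X.cornerVertex c = X.cornerVertex c' → φ.corner c = φ.corner c' → c = c'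

/-- The edge of `L` to which an edge of `X` is mapped. -/
def edge (φ : CombMap X L) (e : X.E) : L.E := (φ.dart (e, true)).1

theorem dart_fst (φ : CombMap X L) (d : X.Dart) : (φ.dart d).1 = φ.edge d.1 := by
  obtain ⟨e, b⟩ := d
  cases b
  · have h := congrArg Prod.fst (φ.dart_rev (e, true))
    exact h
  · rfl

/-- The preimage of a subcomplex. -/
def preimage (φ : CombMap X L) (K : L.Subcomplex) : X.Subcomplex where
  verts := {v | φ.vert v ∈ K.verts}
  edges := {e | φ.edge e ∈ K.edges}
  faces := {f | φ.face f ∈ K.faces}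
  src_mem e he := by
    have h := φ.init_dart (e, true)
    have h1 := K.src_mem _ he
    have h2 := K.tgt_mem _ he
    simp only [Set.mem_ofPred_eq]
    change _ = φ.vert (X.src e) at h
    rw [← h, DirGraph.init]
    split_ifs
    exacts [h1, h2]
  tgt_mem e he := by
    have h := φ.init_dart (e, false)
    have h0 := φ.dart_fst (e, false)
    have h1 := K.src_mem _ he
    have h2 := K.tgt_mem _ he
    simp only [Set.mem_ofPred_eq]
    change _ = φ.vert (X.tgt e) at h
    rw [← h, DirGraph.init, h0]
    split_ifs
    exacts [h1, h2]
  side_mem f hf i := by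
    have h := K.side_mem _ hf (φ.sideMap f i)
    rw [φ.side_sideMap] at h
    simp only [Set.mem_ofPred_eq]
    rw [← φ.dart_fst]
    split_ifs at h
    exacts [h, h]

end CombMap

/-! ### Non-positive immersion -/

/-- Collapsing non-positive immersion. (Finite complexes have copies in every universe.) -/
def CollapsingNPI (L : TwoComplex.{u}) : Prop :=
  ∀ (X : TwoComplex.{u}) (φ : CombMap X L), φ.IsImmersion → X.IsFinite → X.IsConnected →
    (∀ v, ¬ X.IsFreeVertex v) → (∀ e, ¬ X.IsFreeEdge e) → X.eulerChar ≤ 0 ∨ X.IsPoint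

/-- Relative collapsing non-positive immersion of the pair `(L, K)`. -/
def RelCollapsingNPI (L : TwoComplex.{u}) (K : L.Subcomplex) : Prop :=
  ∀ (X : TwoComplex.{u}) (φ : CombMap X L), φ.IsImmersion → X.IsFinite → X.IsConnected →
    (∀ v, ¬ X.IsFreeVertex v) → (∀ e, ¬ X.IsFreeEdge e) →
      X.eulerChar ≤ (φ.preimage K).essentialPart.toComplex.eulerChar ∨ X.IsPoint

/-! ### Zero/one-angle structures and the coloring test -/

/-- An assignment of angles 0 or 1 to the corners. -/
structure ZeroOneAngles (L : TwoComplex.{u}) : Type u where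
  ω : L.Corner → ℤ
  zero_or_one : ∀ c, ω c = 0 ∨ ω c = 1

/-- The curvature of a 2-cell: the sum of its angles minus (number of its sides minus 2). -/
def curvature (L : TwoComplex.{u}) (A : L.ZeroOneAngles) (f : L.F) : ℤ :=
  (∑ i : ZMod (L.len f), A.ω ⟨f, i⟩) - ((L.len f : ℤ) - 2)

/-- The start of an oriented corner, that is, of an oriented edge of a link. -/
def linkStart (L : TwoComplex.{u}) (c : L.Corner × Bool) : L.Dart :=
  if c.2 = true then L.cornerFst c.1 else L.cornerSnd c.1

/-- The end of an oriented corner. -/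
def linkEnd (L : TwoComplex.{u}) (c : L.Corner × Bool) : L.Dart :=
  if c.2 = true then L.cornerSnd c.1 else L.cornerFst c.1

/-- `c 0, …, c (n - 1)` is a reduced cycle in the link of a vertex: a closed path of oriented
corners in which, cyclically, no corner is followed by its own reverse. (The links of distinct
vertices have no vertex in common, so consecutive corners lie in the same link.) -/
def IsReducedLinkCycle (L : TwoComplex.{u}) (n : ℕ) (c : ZMod n → L.Corner × Bool) : Prop :=
  (∀ i, L.linkEnd (c i) = L.linkStart (c (i + 1))) ∧ ∀ i, c (i + 1) ≠ ((c i).1, !(c i).2)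

/-- The coloring test. -/
def SatisfiesColoringTest (L : TwoComplex.{u}) (A : L.ZeroOneAngles) : Prop :=
  (∀ f, L.curvature A f ≤ 0) ∧
    ∀ (n : ℕ) [NeZero n] (c : ZMod n → L.Corner × Bool), L.IsReducedLinkCycle n c →
      2 - ∑ i, A.ω (c i).1 ≤ 0

/-- Two link vertices lie in the same component of `lk₀`, the subgraph of the link formed by
all its vertices and the corners of angle 0. -/
def SameComponentLk0 (L : TwoComplex.{u}) (A : L.ZeroOneAngles) (d d' : L.Dart) : Prop :=
  Relation.EqvGen (fun a b => ∃ c : L.Corner, A.ω c = 0 ∧ L.cornerFst c = a ∧ L.cornerSnd c = b)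
    d d'

/-! ### Folding -/

open Classical in
/-- The folding map on edges: every edge of `K` goes to `y`. The edges of the folded
complex are `y` and the edges of `L` outside `K`. -/
noncomputable def foldEdge (L : TwoComplex.{u}) (K : L.Subcomplex) (y : L.E) (e : L.E) :
    {e : L.E // e ∉ K.edges ∨ e = y} :=
  if h : e ∈ K.edges then ⟨y, Or.inr rfl⟩ else ⟨e, Or.inl h⟩

/-- The quotient of a standard 2-complex `L` obtained by folding the subcomplex `K`, all of whose
2-cells have exponent sum zero, to its edge `y`: all edges of `K` are identified with `y`,
respecting directions, the 2-cells of `K` are folded into `y`, and the remaining 2-cells of `L` are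
attached along the images of their attaching paths. -/
noncomputable def fold (L : TwoComplex.{u}) (hL : L.IsStandard) (K : L.Subcomplex) (y : L.E) :
    TwoComplex.{u} where
  V := L.V
  E := {e : L.E // e ∉ K.edges ∨ e = y}
  src e := L.src e
  tgt e := L.tgt e
  F := {f : L.F // f ∉ K.faces}
  len f := L.len f
  len_ne f := L.len_ne f
  side f i := (L.foldEdge K y (L.side f i).1, (L.side f i).2)
  closed _ _ := hL.2.elim _ _

end TwoComplex

/-! The proof is a combinatorial Gauss-Bonnet argument on `X`, with angles pulled back from the
folded complex. Let `Y` be the essential part of the preimage of `K`. Call cells of `X` outside `Y`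
outer, and let the excess of a vertex be the number of its outer darts minus the number of its outer
corners of angle 0. Outer darts count every outer edge twice. Non-positive curvature gives every
outer 2-cell at least two zero corners. Hence `2 χ(X)` plus the total excess over `Y` is at most `2
χ(Y)`, provided the excess is at least 2 at every vertex outside `Y` (`two_mul_eulerChar_add_le`).

The bounds on the excess come from the coloring test: the angle-0 part of a link of the folded
complex is a forest, since a reduced cycle in it would have angle sum 0, and no corner of angle 1
joins two points of one component, since it would close up to a reduced cycle of angle sum 1. The
zero corners at a vertex of `X` embed in this forest as edges. Their ends are images of outer darts,
or `y⁺` or `y⁻` for darts of `Y`. A forest has fewer edges than vertices, with difference 1 only if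
it is connected. The separation of `y⁺` from `y⁻` therefore gives excess at least 0 everywhere.
Outside `Y`, excess 1 would make every corner an edge of a tree, and a leaf of that tree would yield
a free edge or, without corners, a free vertex.

For the absolute statement, split `Y` into components. By the hypothesis on `K`, a component has `χ
≤ 0` or collapses to a point. In the second case, exponent sum zero yields a height function,
increasing by 1 along each edge (`eulerChar_nonpos_or_exists_isHeight`). The component has a free
edge, which is not free in `X`, so outer 2-cells meet the component. At the lowest and the highest
vertex where they do, only one of `y⁺`, `y⁻` is relevant, and the excess is at least 1
(`two_le_sum_excess`). So the excess of each component pays for twice its Euler characteristic. -/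

/-! ### Oriented multigraphs

A multigraph with vertices `D` and edges `C` is given by a map `s : C × Bool → D`, where `s (c, true)`
and `s (c, false)` are the two ends of the edge `c`. The oriented edge `(c, b)` runs from `s (c, b)`
to `s (c, !b)`. -/

namespace OrientedGraph

variable {C D : Type*}

/-- No reduced cycle consists of edges satisfying `P`. -/
def IsForest (s : C × Bool → D) (P : C → Prop) : Prop :=
  ∀ (n : ℕ) [NeZero n] (c : ZMod n → C × Bool), (∀ i, P (c i).1) →
    (∀ i, s ((c i).1, !(c i).2) = s (c (i + 1))) → ∃ i, c (i + 1) = ((c i).1, !(c i).2)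

/-- Two vertices are joined by edges satisfying `P`. -/
def Joined (s : C × Bool → D) (P : C → Prop) (d d' : D) : Prop :=
  Relation.EqvGen (fun a b => ∃ c, P c ∧ s (c, true) = a ∧ s (c, false) = b) d d'

theorem Joined.of_edge {s : C × Bool → D} {P : C → Prop} {c : C} (hc : P c) (b : Bool) :
    Joined s P (s (c, b)) (s (c, !b)) := by
  cases b
  · exact (Relation.EqvGen.rel _ _ ⟨c, hc, rfl, rfl⟩).symm
  · exact Relation.EqvGen.rel _ _ ⟨c, hc, rfl, rfl⟩

/-- Turns a periodic orbit into a cycle indexed by `ZMod n`. The case `n = 1` is separate because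
there `1 = 0`. -/
theorem iterate_val_add_one {α : Type*} (f : α → α) (x : α) (n : ℕ) [NeZero n]
    (h : f^[n] x = x) (i : ZMod n) : f^[(i + 1).val] x = f (f^[i.val] x) := by
  have hp : Function.IsPeriodicPt f n x := h
  rw [ZMod.val_add, hp.iterate_mod_apply, ← Function.iterate_succ_apply' f]
  rcases Nat.lt_or_ge 1 n with h1 | h1
  · have : Fact (1 < n) := ⟨h1⟩
    rw [ZMod.val_one]
  · have hn : n = 1 := le_antisymm h1 (Nat.one_le_iff_ne_zero.2 (NeZero.ne n))
    subst hn
    have hx : f x = x := h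
    rw [Function.iterate_fixed hx, Function.iterate_fixed hx]

theorem exists_iterate_eq_self {α : Type*} [Finite α] [Nonempty α] (f : α → α) :
    ∃ n, n ≠ 0 ∧ ∃ x, f^[n] x = x := by
  obtain ⟨x⟩ := ‹Nonempty α›
  obtain ⟨i, j, hij, h⟩ := Finite.exists_ne_map_eq_of_infinite (fun n : ℕ => f^[n] x)
  wlog hlt : i < j generalizing i j
  · exact this j i hij.symm h.symm (by omega)
  refine ⟨j - i, by omega, f^[i] x, ?_⟩
  rw [← Function.iterate_add_apply, Nat.sub_add_cancel hlt.le]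
  exact h.symm

/-- The vertex `d` has valency one in the graph with edges `Es`. -/
def IsLeaf (s : C × Bool → D) (Es : Finset C) (d : D) : Prop :=
  ∃! o : C × Bool, o.1 ∈ Es ∧ s o = d

/-- Without leaves a walk can always be continued without backtracking. The successor map on the
finitely many oriented edges then has a periodic orbit, which is a reduced cycle. -/
theorem IsForest.exists_isLeaf {s : C × Bool → D} {P : C → Prop} (hs : IsForest s P)
    {Es : Finset C} (hE : ∀ c ∈ Es, P c) (hne : Es.Nonempty) : ∃ d, IsLeaf s Es d := by
  classical
  by_contra! hno
  have hnext : ∀ o : {o : C × Bool // o.1 ∈ Es}, ∃ o' : {o : C × Bool // o.1 ∈ Es},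
      s o' = s (o.1.1, !o.1.2) ∧ o'.1 ≠ (o.1.1, !o.1.2) := by
    intro o
    by_contra! h
    refine hno (s (o.1.1, !o.1.2)) ⟨(o.1.1, !o.1.2), ⟨o.2, rfl⟩, ?_⟩
    rintro o' ⟨h1, h2⟩
    exact h ⟨o', h1⟩ h2
  choose f hf1 hf2 using hnext
  obtain ⟨c0, hc0⟩ := hne
  have : Nonempty {o : C × Bool // o.1 ∈ Es} := ⟨⟨(c0, true), hc0⟩⟩
  have : Finite {o : C × Bool // o.1 ∈ Es} := by
    refine Set.Finite.to_subtype (((Es.finite_toSet).prod (Set.finite_univ (α := Bool))).subset ?_)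
    intro o ho
    exact ⟨ho, trivial⟩
  obtain ⟨n, hn, x, hx⟩ := exists_iterate_eq_self f
  have : NeZero n := ⟨hn⟩
  obtain ⟨i, hi⟩ := hs n (fun i => (f^[i.val] x).1) (fun i => hE _ (f^[i.val] x).2)
    (fun i => by rw [iterate_val_add_one f x n hx, hf1])
  simp only [iterate_val_add_one f x n hx] at hi
  exact hf2 _ hi

theorem IsLeaf.exists_edge {s : C × Bool → D} {Es : Finset C} {d : D} (h : IsLeaf s Es d) :
    ∃ c ∈ Es, ∃ b, s (c, b) = d ∧ s (c, !b) ≠ d ∧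
      ∀ c' ∈ Es, ∀ b', s (c', b') = d → c' = c ∧ b' = b := by
  obtain ⟨⟨c, b⟩, ⟨hc, hd⟩, hu⟩ := h
  refine ⟨c, hc, b, hd, fun hd' => ?_, fun c' hc' b' h' => ?_⟩
  · have := hu (c, !b) ⟨hc, hd'⟩
    simp at this
  · simpa using hu (c', b') ⟨hc', h'⟩

/-- If the leaf found is `p`, remove its edge. Either nothing is left and the other end is a leaf,
or the rest has a leaf different from that end, which stays a leaf when the edge is put back. -/
theorem IsForest.exists_isLeaf_ne {s : C × Bool → D} {P : C → Prop} (hs : IsForest s P)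
    {Es : Finset C} (hE : ∀ c ∈ Es, P c) (hne : Es.Nonempty) (p : D) :
    ∃ d, d ≠ p ∧ IsLeaf s Es d := by
  classical
  induction hk : Es.card generalizing Es p with
  | zero => simp [hne.ne_empty] at hk
  | succ k ih =>
    obtain ⟨d, hd⟩ := hs.exists_isLeaf hE hne
    by_cases hdp : d = p
    swap
    · exact ⟨d, hdp, hd⟩
    subst hdp
    obtain ⟨c, hc, b, h1, h2, h3⟩ := hd.exists_edge
    by_cases hE' : (Es.erase c).Nonempty
    · obtain ⟨d', hd', hl⟩ := ih (fun c' h' => hE c' (Finset.mem_of_mem_erase h')) hE'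
        (s (c, !b)) (by rw [Finset.card_erase_of_mem hc]; omega)
      obtain ⟨⟨c', b'⟩, ⟨hc', hs'⟩, hu⟩ := hl
      rw [Finset.mem_erase] at hc'
      refine ⟨d', ?_, ⟨(c', b'), ⟨hc'.2, hs'⟩, ?_⟩⟩
      · rintro rfl
        exact hc'.1 (h3 c' hc'.2 b' hs').1
      · rintro ⟨c'', b''⟩ ⟨ho1, ho2⟩
        refine hu _ ⟨Finset.mem_erase.2 ⟨?_, ho1⟩, ho2⟩
        simp only
        rintro rfl
        by_cases hb : b'' = b
        · subst hb
          rw [h1] at ho2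
          subst ho2
          exact hc'.1 (h3 c' hc'.2 b' hs').1
        · have : b'' = !b := by cases b <;> cases b'' <;> simp_all
          subst this
          exact hd' ho2.symm
    · rw [Finset.not_nonempty_iff_eq_empty] at hE'
      have hEc : ∀ c' ∈ Es, c' = c := by
        intro c' hc'
        by_contra hcc
        exact absurd (Finset.mem_erase.2 ⟨hcc, hc'⟩) (by simp [hE'])
      refine ⟨s (c, !b), h2, ⟨(c, !b), ⟨hc, rfl⟩, ?_⟩⟩
      rintro ⟨c', b'⟩ ⟨ho1, ho2⟩
      obtain rfl := hEc c' ho1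
      by_cases hb : b' = b
      · subst hb
        exact absurd (ho2.symm.trans h1) h2
      · have : b' = !b := by cases b <;> cases b' <;> simp_all
        rw [this]

/-- Stripping a leaf removes one edge and one vertex, so the difference is preserved until only
vertices remain. `Vs` may contain isolated vertices; equality means that exactly one vertex remains.
-/
theorem IsForest.card_add_one_le {s : C × Bool → D} {P : C → Prop} (hs : IsForest s P)
    {Es : Finset C} {Vs : Finset D} (hE : ∀ c ∈ Es, P c) (hV : ∀ c ∈ Es, ∀ b, s (c, b) ∈ Vs)
    (hne : Vs.Nonempty) : Es.card + 1 ≤ Vs.card ∧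
      (Vs.card = Es.card + 1 → ∀ d ∈ Vs, ∀ d' ∈ Vs, Joined s P d d') := by
  classical
  induction hk : Es.card generalizing Es Vs with
  | zero =>
    refine ⟨by have := hne.card_pos; omega, fun h d hd d' hd' => ?_⟩
    rw [Finset.card_le_one.1 (by omega) d hd d' hd']
    exact Relation.EqvGen.refl _
  | succ k ih =>
    have hEne : Es.Nonempty := Finset.card_pos.1 (by omega)
    obtain ⟨d, hd⟩ := hs.exists_isLeaf hE hEne
    obtain ⟨c, hc, b, rfl, h2, h3⟩ := hd.exists_edge
    have hdV := hV c hc b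
    have hqV : s (c, !b) ∈ Vs.erase (s (c, b)) := Finset.mem_erase.2 ⟨h2, hV c hc _⟩
    have hcard := Finset.card_erase_of_mem hdV
    have hpos : 0 < Vs.card := hne.card_pos
    obtain ⟨i1, i2⟩ := ih (Es := Es.erase c) (Vs := Vs.erase (s (c, b)))
      (fun c' h' => hE c' (Finset.mem_of_mem_erase h'))
      (fun c' h' b' => by
        rw [Finset.mem_erase] at h'
        exact Finset.mem_erase.2 ⟨fun h => h'.1 (h3 c' h'.2 b' h).1, hV c' h'.2 b'⟩)
      ⟨_, hqV⟩ (by rw [Finset.card_erase_of_mem hc]; omega)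
    refine ⟨by omega, fun h => ?_⟩
    have key : ∀ x ∈ Vs, Joined s P x (s (c, !b)) := by
      intro x hx
      by_cases hxd : x = s (c, b)
      · rw [hxd]
        exact Joined.of_edge (hE c hc) b
      · exact i2 (by omega) x (Finset.mem_erase.2 ⟨hxd, hx⟩) _ hqV
    intro x hx x' hx'
    exact (key x hx).trans _ _ _ (key x' hx').symm

/-- There is a path with `n` edges satisfying `P` from `d` to `a`. -/
def Reach (s : C × Bool → D) (P : C → Prop) (a : D) : ℕ → D → Prop
  | 0, d => d = a
  | n + 1, d => ∃ o : C × Bool, P o.1 ∧ s o = d ∧ Reach s P a n (s (o.1, !o.2))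

theorem Joined.exists_reach {s : C × Bool → D} {P : C → Prop} {a d : D} (h : Joined s P d a) :
    ∃ n, Reach s P a n d := by
  have hstep : ∀ c, P c → ∀ b, (∃ n, Reach s P a n (s (c, b))) → ∃ n, Reach s P a n (s (c, !b)) := by
    rintro c hc b ⟨n, hn⟩
    exact ⟨n + 1, (c, !b), hc, rfl, by simpa using hn⟩
  have key : ∀ x z, Joined s P x z → ((∃ n, Reach s P a n x) ↔ ∃ n, Reach s P a n z) := by
    intro x z h
    induction h with
    | rel x z h =>
      obtain ⟨c, hc, rfl, rfl⟩ := h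
      exact ⟨hstep c hc true, hstep c hc false⟩
    | refl => rfl
    | symm _ _ _ ih => exact ih.symm
    | trans _ _ _ _ _ ih1 ih2 => exact ih1.trans ih2
  exact (key d a h).2 ⟨0, rfl⟩

/-- If an edge that does not satisfy `P` has its ends joined by edges that satisfy `P`, then there
is a reduced cycle that runs over this edge once and otherwise over edges satisfying `P`. -/
theorem exists_reduced_cycle_of_joined {s : C × Bool → D} {P : C → Prop} {e : C} (he : ¬ P e)
    (h : Joined s P (s (e, false)) (s (e, true))) :
    ∃ (n : ℕ) (_ : NeZero n) (c : ZMod n → C × Bool),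
      (∀ i, s ((c i).1, !(c i).2) = s (c (i + 1))) ∧ (∀ i, c (i + 1) ≠ ((c i).1, !(c i).2)) ∧
      ∃ i0, (c i0).1 = e ∧ ∀ i, i ≠ i0 → P (c i).1 := by
  classical
  set a := s (e, true) with ha
  let R : D → Prop := fun d => ∃ n, Reach s P a n d
  -- Distance to `a` along edges satisfying `P`; the value 0 off `R` is a dummy.
  let dist : D → ℕ := fun d => if h : R d then Nat.find h else 0
  have hdist : ∀ d, R d → Reach s P a (dist d) d := by
    intro d hd
    simp only [dist, dif_pos hd]
    exact Nat.find_spec hd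
  have hmin : ∀ d n, Reach s P a n d → dist d ≤ n := by
    intro d n hn
    have hd : R d := ⟨n, hn⟩
    simp only [dist, dif_pos hd]
    exact Nat.find_min' hd hn
  -- The next oriented edge at `d`: the first edge of a shortest path to `a`, and at `a` itself the
  -- edge `e`, which leads back to `s (e, false)`.
  have hstep : ∀ d, ∃ o : C × Bool, (d = a → o = (e, true)) ∧ (R d → d ≠ a → P o.1 ∧ s o = d ∧
      R (s (o.1, !o.2)) ∧ dist (s (o.1, !o.2)) + 1 = dist d) := by
    intro d
    by_cases hda : d = a
    · exact ⟨(e, true), fun _ => rfl, fun _ h => absurd hda h⟩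
    by_cases hR : R d
    swap
    · exact ⟨(e, true), fun _ => rfl, fun h => absurd h hR⟩
    have hr := hdist d hR
    cases hn : dist d with
    | zero =>
      rw [hn] at hr
      exact absurd hr hda
    | succ k =>
      rw [hn] at hr
      obtain ⟨o, ho1, ho2, ho3⟩ := hr
      refine ⟨o, fun h => absurd h hda, fun _ _ => ⟨ho1, ho2, ⟨k, ho3⟩, ?_⟩⟩
      have h1 := hmin _ _ ho3
      have h2 := hmin d (dist (s (o.1, !o.2)) + 1) ⟨o, ho1, ho2, hdist _ ⟨k, ho3⟩⟩
      omega
  choose g hga hgd using hstep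
  let F : D → D := fun d => s ((g d).1, !(g d).2)
  set b := s (e, false) with hb
  have hFa : F a = b := by simp [F, hga a rfl, hb]
  have hgs : ∀ d, R d → s (g d) = d := by
    intro d hd
    by_cases hda : d = a
    · rw [hga d hda, hda]
    · exact (hgd d hd hda).2.1
  have hRb : R b := h.exists_reach
  have hdist0 : ∀ d, R d → (dist d = 0 ↔ d = a) := by
    intro d hd
    constructor
    · intro h0
      have := hdist d hd
      rwa [h0] at this
    · rintro rfl
      exact Nat.le_zero.1 (hmin a 0 rfl)
  have hiter : ∀ k, k ≤ dist b → R (F^[k] b) ∧ dist (F^[k] b) + k = dist b := by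
    intro k
    induction k with
    | zero => exact fun _ => ⟨hRb, rfl⟩
    | succ k ih =>
      intro hk
      obtain ⟨h1, h2⟩ := ih (by omega)
      have hne : F^[k] b ≠ a := by
        rw [Ne, ← hdist0 _ h1]
        omega
      obtain ⟨-, -, h3, h4⟩ := hgd _ h1 hne
      rw [Function.iterate_succ_apply']
      refine ⟨h3, ?_⟩
      change dist (F (F^[k] b)) + 1 = _ at h4
      omega
  have hlast : F^[dist b] b = a := by
    obtain ⟨h1, h2⟩ := hiter _ le_rfl
    rw [← hdist0 _ h1]
    omega
  have hper : F^[dist b + 1] b = b := by rw [Function.iterate_succ_apply', hlast, hFa]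
  have hval : ∀ i : ZMod (dist b + 1), i.val ≤ dist b := fun i => Nat.lt_succ_iff.1 (ZMod.val_lt i)
  have hR : ∀ i : ZMod (dist b + 1), R (F^[i.val] b) := fun i => (hiter _ (hval i)).1
  have hnext := iterate_val_add_one F b (dist b + 1) hper
  refine ⟨dist b + 1, inferInstance, fun i => g (F^[i.val] b), fun i => ?_, fun i => ?_,
    (dist b : ℕ), ?_, fun i hi => ?_⟩
  · rw [hgs _ (hR _), hnext]
  -- Turning back on the path would raise the distance just lowered. Turning back at `e` would need
  -- an edge of the path equal to `e`, or `e` equal to its own reverse.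
  · have h1 := hR (i + 1)
    simp only [hnext] at h1 ⊢
    intro heq
    by_cases hda : F^[i.val] b = a
    · rw [hga _ hda] at heq
      by_cases hda' : F (F^[i.val] b) = a
      · rw [hga _ hda'] at heq
        simp at heq
      · have := (hgd _ h1 hda').1
        rw [heq] at this
        exact he this
    · obtain ⟨p1, p2, p3, p4⟩ := hgd _ (hR i) hda
      by_cases hda' : F (F^[i.val] b) = a
      · rw [hga _ hda'] at heq
        exact he (by have h2 := congrArg Prod.fst heq; simp only at h2; rw [h2]; exact p1)
      · obtain ⟨q1, q2, q3, q4⟩ := hgd _ h1 hda'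
        rw [heq] at q4
        simp only [Bool.not_not] at q4
        rw [Prod.mk.eta, p2] at q4
        change dist (F (F^[i.val] b)) + 1 = _ at p4
        omega
  · have : (((dist b : ℕ) : ZMod (dist b + 1))).val = dist b := ZMod.val_cast_of_lt (by omega)
    simp only [this, hlast, hga a rfl]
  · refine (hgd _ (hR i) fun hda => hi ?_).1
    have h2 := (hiter _ (hval i)).2
    rw [(hdist0 _ (hR i)).2 hda] at h2
    rw [← ZMod.natCast_zmod_val i]
    congr 1
    omega

end OrientedGraph

namespace TwoComplex

open OrientedGraph

/-! ### Links -/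

variable {X L : TwoComplex.{u}}

theorem linkStart_not (c : X.Corner) (b : Bool) : X.linkStart (c, !b) = X.linkEnd (c, b) := by
  cases b <;> rfl

theorem init_linkStart (c : X.Corner) (b : Bool) :
    X.init (X.linkStart (c, b)) = X.cornerVertex c := by
  cases b
  · rfl
  · exact X.closed c.1 c.2

/-- The end of a corner at the dart `d` that belongs to a side over the edge of `d`. -/
def sideLink (X : TwoComplex.{u}) [DecidableEq X.Dart] (d : X.Dart) (c : X.Corner) :
    X.Corner × Bool :=
  if X.side c.1 c.2 = d then (⟨c.1, c.2 - 1⟩, false) else (c, true)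

theorem linkStart_sideLink [DecidableEq X.Dart] {d : X.Dart} {c : X.Corner}
    (h : (X.side c.1 c.2).1 = d.1) : X.linkStart (X.sideLink d c) = d := by
  unfold sideLink
  split_ifs with h1
  · change X.side c.1 (c.2 - 1 + 1) = d
    rw [sub_add_cancel, h1]
  · change X.rev (X.side c.1 c.2) = d
    refine Prod.ext h ?_
    have h2 : (X.side c.1 c.2).2 ≠ d.2 := fun h2 => h1 (Prod.ext h h2)
    change (!(X.side c.1 c.2).2) = d.2
    revert h2
    cases (X.side c.1 c.2).2 <;> cases d.2 <;> simp

theorem sideLink_injective [DecidableEq X.Dart] (d : X.Dart) :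
    Function.Injective (X.sideLink d) := by
  rintro ⟨f, i⟩ ⟨f', i'⟩ h
  unfold sideLink at h
  split_ifs at h
  · simp only [Prod.mk.injEq, Sigma.mk.injEq, and_true] at h
    obtain ⟨rfl, h⟩ := h
    rw [heq_eq_eq, sub_left_inj] at h
    rw [h]
  · simp at h
  · simp at h
  · simpa using h

theorem exists_side_of_linkStart {d : X.Dart} {o : X.Corner × Bool} (h : X.linkStart o = d) :
    ∃ i, (X.side o.1.1 i).1 = d.1 := by
  obtain ⟨c, b⟩ := o
  subst h
  cases b
  · exact ⟨c.2 + 1, rfl⟩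
  · exact ⟨c.2, rfl⟩

/-- Sides over the edge of `d` correspond injectively to corner ends at `d` through `sideLink`, so
valency one in the link leaves a single side. -/
theorem isFreeEdge_of_existsUnique {d : X.Dart} (h : ∃! o : X.Corner × Bool, X.linkStart o = d) :
    X.IsFreeEdge d.1 := by
  classical
  obtain ⟨o, ho, hu⟩ := h
  obtain ⟨i, hi⟩ := exists_side_of_linkStart ho
  refine ⟨⟨o.1.1, i⟩, hi, fun c hc => X.sideLink_injective d ?_⟩
  rw [hu _ (linkStart_sideLink hc), hu _ (linkStart_sideLink (c := ⟨o.1.1, i⟩) hi)]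

theorem exists_init_eq (hX : X.IsConnected) (hp : ¬ X.IsPoint) (v : X.V) :
    ∃ d : X.Dart, X.init d = v := by
  by_contra! hno
  have hE : ∀ a b, Relation.EqvGen (fun a b => ∃ e : X.E, X.src e = a ∧ X.tgt e = b) a b →
      (a = v ↔ b = v) := by
    intro a b h
    induction h with
    | rel a b h =>
      obtain ⟨e, rfl, rfl⟩ := h
      exact ⟨fun h => absurd h (hno (e, true)), fun h => absurd h (hno (e, false))⟩
    | refl => rfl
    | symm _ _ _ ih => exact ih.symm
    | trans _ _ _ _ _ ih1 ih2 => exact ih1.trans ih2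
  have hv : ∀ w, w = v := fun w => (hE _ _ (hX.2 v w)).1 rfl
  have hEe : IsEmpty X.E := ⟨fun e => hno (e, true) (hv _)⟩
  exact hp ⟨hX.1, ⟨fun a b => (hv a).trans (hv b).symm⟩, hEe, ⟨fun f => hEe.false (X.side f 0).1⟩⟩

/-! ### Forests in links -/

theorem SatisfiesColoringTest.isForest {A : L.ZeroOneAngles} (hA : L.SatisfiesColoringTest A) :
    IsForest L.linkStart (fun c => A.ω c = 0) := by
  intro n _ c hc hcl
  by_contra! hr
  have := hA.2 n c ⟨fun i => by rw [← hcl i, linkStart_not], hr⟩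
  rw [Finset.sum_eq_zero fun i _ => hc i] at this
  omega

/-- Otherwise this corner and a path of zero corners would form a reduced cycle of angle sum 1. -/
theorem SatisfiesColoringTest.not_joined {A : L.ZeroOneAngles} (hA : L.SatisfiesColoringTest A)
    {c : L.Corner} (hc : A.ω c ≠ 0) (b : Bool) :
    ¬ Joined L.linkStart (fun c => A.ω c = 0) (L.linkStart (c, b)) (L.linkStart (c, !b)) := by
  intro h
  have h' : Joined L.linkStart (fun c => A.ω c = 0) (L.linkStart (c, false))
      (L.linkStart (c, true)) := by
    cases b
    · exact h
    · exact h.symm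
  obtain ⟨n, hn, p, hp1, hp2, i0, hi0, hi⟩ := exists_reduced_cycle_of_joined
    (s := L.linkStart) (P := fun c => A.ω c = 0) hc h'
  have := hA.2 n p ⟨fun i => by rw [← hp1 i, linkStart_not], hp2⟩
  rw [Finset.sum_eq_single i0 (fun i _ h => hi i h) (by simp), hi0,
    (A.zero_or_one c).resolve_left hc] at this
  omega

/-! ### Maps to a folded complex -/

/-- The folding map on darts. -/
noncomputable def foldProj (L : TwoComplex.{u}) (hL : L.IsStandard) (K : L.Subcomplex) (y : L.E)
    (d : L.Dart) : (L.fold hL K y).Dart :=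
  (L.foldEdge K y d.1, d.2)

namespace CombMap

variable (φ : CombMap X L) (hL : L.IsStandard) (K : L.Subcomplex) (y : L.E)

/-- A reflected polygon swaps the two ends of each corner; `b == φ.orient c.1` records this. -/
theorem linkStart_corner (c : X.Corner) (b : Bool) :
    L.linkStart (φ.corner c, b) = φ.dart (X.linkStart (c, b == φ.orient c.1)) := by
  obtain ⟨f, i⟩ := c
  have h1 := φ.side_sideMap f i
  have h2 := φ.side_sideMap f (i + 1)
  have h3 := φ.sideMap_add_one f i
  have h4 := φ.dart_rev
  unfold corner
  cases ho : φ.orient f <;> simp only [ho, if_true, Bool.false_eq_true, if_false] at h1 h2 h3 <;>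
    cases b <;> simp only [linkStart, cornerFst, cornerSnd, beq_self_eq_true, if_true,
      Bool.false_eq_true, if_false, beq_iff_eq, reduceCtorEq]
  · simp only [h3, sub_add_cancel, h1, h4]
  · rw [h2]
    simp [DirGraph.rev]
  · rw [← h3, h2]
  · rw [h1, h4]

/-- The corners of `X` that are not mapped to `K`. -/
abbrev OuterCorner : Type u := {c : X.Corner // φ.face c.1 ∉ K.faces}

/-- The composition of a map with the folding map, on darts. -/
noncomputable def foldDart (d : X.Dart) : (L.fold hL K y).Dart := L.foldProj hL K y (φ.dart d)

/-- The composition of a map with the folding map, on the corners that are not mapped to `K`. -/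
def foldCorner (c : φ.OuterCorner K) : (L.fold hL K y).Corner :=
  ⟨⟨φ.face c.1.1, c.2⟩, (φ.corner c.1).2⟩

theorem linkStart_foldCorner (c : φ.OuterCorner K) (b : Bool) :
    (L.fold hL K y).linkStart (φ.foldCorner hL K y c, b) =
      φ.foldDart hL K y (X.linkStart (c.1, b == φ.orient c.1.1)) := by
  rw [foldDart, ← linkStart_corner]
  cases b <;> rfl

variable {φ} {K}

/-- Folding identifies edges but no outer 2-cells, so the folded corner still determines the corner
of `L`. -/
theorem IsImmersion.foldCorner_inj (hφ : φ.IsImmersion) {c c' : φ.OuterCorner K}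
    (hv : X.cornerVertex c.1 = X.cornerVertex c'.1)
    (h : φ.foldCorner hL K y c = φ.foldCorner hL K y c') : c = c' := by
  refine Subtype.ext (hφ.2 _ _ hv ?_)
  have h1 : (φ.corner c.1) = ⟨(φ.foldCorner hL K y c).1.1, (φ.foldCorner hL K y c).2⟩ := rfl
  rw [h1, h]
  rfl

variable (φ) (K)

/-- The darts at `v` outside the essential part of the preimage of `K`. -/
def outerDarts (v : X.V) : Set X.Dart :=
  {d | X.init d = v ∧ d.1 ∉ (φ.preimage K).essentialPart.edges}

/-- The corners of angle zero at `v` that are not mapped to `K`. -/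
def zeroCorners {K : L.Subcomplex} {y : L.E} (A : (L.fold hL K y).ZeroOneAngles) (v : X.V) :
    Set (φ.OuterCorner K) :=
  {c | X.cornerVertex c.1 = v ∧ A.ω (φ.foldCorner hL K y c) = 0}

variable {φ} {K} {hL} {y}

theorem face_notMem_of_linkStart {o : X.Corner × Bool}
    (h : (X.linkStart o).1 ∉ (φ.preimage K).essentialPart.edges) : φ.face o.1.1 ∉ K.faces := by
  intro hf
  obtain ⟨i, hi⟩ := exists_side_of_linkStart (rfl : X.linkStart o = _)
  exact h ⟨_, hf, i, hi.symm⟩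

theorem foldDart_of_mem {d : X.Dart} (hd : d.1 ∈ (φ.preimage K).essentialPart.edges) :
    φ.foldDart hL K y d = (⟨y, Or.inr rfl⟩, (φ.dart d).2) := by
  obtain ⟨f, hf, i, hi⟩ := hd
  have hk : (φ.dart d).1 ∈ K.edges := by
    rw [φ.dart_fst, hi]
    exact (φ.preimage K).side_mem f hf i
  simp [foldDart, foldProj, foldEdge, hk]

/-! ### Estimates of the excess at a single vertex -/

variable [Finite X.E] [Finite X.F]

instance : Finite X.Corner := by
  unfold Corner
  infer_instance

instance : Finite (φ.OuterCorner K) := by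
  unfold OuterCorner
  infer_instance

variable {A : (L.fold hL K y).ZeroOneAngles}

/-- The basic estimate at a vertex `v`: the set `P` contains at most one vertex of the link, and it
contains the images of all vertices of the link of `v` which belong to the essential part of the
preimage of `K` and at which there is an outer corner. -/
theorem zeroCorners_ncard_add_one_le (hφ : φ.IsImmersion) (hfree : ∀ e, ¬ X.IsFreeEdge e)
    (hA : (L.fold hL K y).SatisfiesColoringTest A) {v : X.V} {P : Finset (L.fold hL K y).Dart}
    (hP : P.card ≤ 1)
    (hcov : ∀ c : φ.OuterCorner K, X.cornerVertex c.1 = v → ∀ b,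
      φ.foldDart hL K y (X.linkStart (c.1, b)) ∈ P ∨
        (X.linkStart (c.1, b)).1 ∉ (φ.preimage K).essentialPart.edges)
    (hne : P.Nonempty ∨ (φ.outerDarts K v).Nonempty) :
    (φ.zeroCorners hL A v).ncard + 1 ≤ (φ.outerDarts K v).ncard + P.card ∧
      ((φ.zeroCorners hL A v).ncard + 1 = (φ.outerDarts K v).ncard + P.card →
        ∀ c : φ.OuterCorner K, X.cornerVertex c.1 ≠ v) := by
  classical
  set N := (φ.outerDarts K v).toFinite.toFinset with hN
  set Z := (φ.zeroCorners hL A v).toFinite.toFinset with hZ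
  rw [Set.ncard_eq_toFinset_card _, Set.ncard_eq_toFinset_card _, ← hN, ← hZ]
  have memN : ∀ d, d ∈ N ↔ X.init d = v ∧ d.1 ∉ (φ.preimage K).essentialPart.edges := by
    simp [hN, outerDarts]
  have memZ : ∀ c, c ∈ Z ↔ X.cornerVertex c.1 = v ∧ A.ω (φ.foldCorner hL K y c) = 0 := by
    simp [hZ, zeroCorners]
  set s := (L.fold hL K y).linkStart with hs
  set Es := Z.image (φ.foldCorner hL K y) with hEs
  set Vs := N.image (φ.foldDart hL K y) ∪ P with hVs
  have hinj : ∀ c c' : φ.OuterCorner K, X.cornerVertex c.1 = v → X.cornerVertex c'.1 = v →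
      φ.foldCorner hL K y c = φ.foldCorner hL K y c' → c = c' := fun c c' h h' heq =>
    hφ.foldCorner_inj hL y (h.trans h'.symm) heq
  have hEcard : Es.card = Z.card := Finset.card_image_of_injOn fun c hc c' hc' h =>
    hinj c c' ((memZ c).1 hc).1 ((memZ c').1 hc').1 h
  have hVcard : Vs.card ≤ N.card + P.card :=
    (Finset.card_union_le _ _).trans (Nat.add_le_add_right Finset.card_image_le _)
  have hends : ∀ c : φ.OuterCorner K, X.cornerVertex c.1 = v → ∀ b,
      s (φ.foldCorner hL K y c, b) ∈ Vs := by
    intro c hc b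
    rw [hs, linkStart_foldCorner, hVs, Finset.mem_union]
    rcases hcov c hc (b == φ.orient c.1.1) with h | h
    · exact Or.inr h
    · exact Or.inl (Finset.mem_image_of_mem _ ((memN _).2 ⟨(init_linkStart _ _).trans hc, h⟩))
  have hE0 : ∀ c ∈ Es, A.ω c = 0 := by
    intro c hc
    obtain ⟨c', hc', rfl⟩ := Finset.mem_image.1 hc
    exact ((memZ _).1 hc').2
  have hVne : Vs.Nonempty := by
    rcases hne with ⟨p, hp⟩ | ⟨d, hd⟩
    · exact ⟨p, Finset.mem_union_right _ hp⟩
    · exact ⟨_, Finset.mem_union_left _ (Finset.mem_image_of_mem _ ((memN d).2 hd))⟩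
  obtain ⟨h1, h2⟩ := hA.isForest.card_add_one_le hE0 (Vs := Vs) (fun c hc b => by
    obtain ⟨c', hc', rfl⟩ := Finset.mem_image.1 hc
    exact hends c' ((memZ _).1 hc').1 b) hVne
  -- In the extremal case the zero corners form a tree on all of `Vs`.
  refine ⟨by omega, fun heq c hc => ?_⟩
  have hjoin := h2 (by omega)
  have hNc : (N.image (φ.foldDart hL K y)).card ≤ N.card := Finset.card_image_le
  have hU : Vs.card ≤ (N.image (φ.foldDart hL K y)).card + P.card := Finset.card_union_le _ _
  have hNinj := Finset.card_image_iff.1 (le_antisymm hNc (by omega))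
  -- A corner of angle 1 would have both ends in this one tree.
  have hzero : ∀ c : φ.OuterCorner K, X.cornerVertex c.1 = v → c ∈ Z := by
    intro c hc
    by_contra hcZ
    rw [memZ] at hcZ
    exact hA.not_joined (fun h => hcZ ⟨hc, h⟩) true (hjoin _ (hends c hc _) _ (hends c hc _))
  have hEne : Es.Nonempty := ⟨_, Finset.mem_image_of_mem _ (hzero c hc)⟩
  have hleaf : ∃ q, q ∉ P ∧ IsLeaf s Es q := by
    rcases P.eq_empty_or_nonempty with rfl | ⟨p, hp⟩
    · obtain ⟨q, hq⟩ := hA.isForest.exists_isLeaf hE0 hEne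
      exact ⟨q, by simp, hq⟩
    · obtain ⟨q, hq, hl⟩ := hA.isForest.exists_isLeaf_ne hE0 hEne p
      exact ⟨q, fun h => hq (Finset.card_le_one.1 hP _ h _ hp), hl⟩
  -- The leaf lies outside `P`, so it comes from an outer dart `d`. All corners at `d` are outer and
  -- of angle 0, hence edges of the tree at `q`; so there is just one, and its edge is free.
  obtain ⟨q, hqP, ⟨c1', b1⟩, ⟨hc1', hq⟩, hu⟩ := hleaf
  obtain ⟨c1, hc1, rfl⟩ := Finset.mem_image.1 hc1'
  have hc1v := ((memZ _).1 hc1).1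
  rw [hs, linkStart_foldCorner] at hq
  set d := X.linkStart (c1.1, b1 == φ.orient c1.1.1) with hd
  have hdY : d.1 ∉ (φ.preimage K).essentialPart.edges := by
    rcases hcov c1 hc1v (b1 == φ.orient c1.1.1) with h | h
    · exact absurd (hq ▸ h) hqP
    · exact h
  have hdv : X.init d = v := (init_linkStart _ _).trans hc1v
  refine hfree _ (isFreeEdge_of_existsUnique (d := d) ⟨(c1.1, b1 == φ.orient c1.1.1), rfl, ?_⟩)
  rintro ⟨c2, b2⟩ hc2
  have hc2v : X.cornerVertex c2 = v := by
    rw [← init_linkStart c2 b2, hc2, hdv]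
  have hc2K : φ.face c2.1 ∉ K.faces := face_notMem_of_linkStart (o := (c2, b2)) (hc2 ▸ hdY)
  have := hu (φ.foldCorner hL K y ⟨c2, hc2K⟩, b2 == φ.orient c2.1)
    ⟨Finset.mem_image_of_mem _ (hzero _ hc2v), by
      rw [hs, linkStart_foldCorner, ← hq, ← hc2]
      congr 3
      cases b2 <;> cases φ.orient c2.1 <;> rfl⟩
  rw [Prod.mk.injEq] at this
  have hcc := hinj _ _ hc2v hc1v this.1
  subst hcc
  rw [Prod.mk.injEq]
  refine ⟨rfl, ?_⟩
  rw [← this.2]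
  simp only
  cases b2 <;> cases φ.orient c2.1 <;> rfl

/-- The estimate at a vertex with outer corners, if all darts of the essential part with outer
corners have images of the same direction. -/
theorem zeroCorners_lt_outerDarts (hφ : φ.IsImmersion) (hfree : ∀ e, ¬ X.IsFreeEdge e)
    (hA : (L.fold hL K y).SatisfiesColoringTest A) {v : X.V} (c0 : φ.OuterCorner K)
    (hc0 : X.cornerVertex c0.1 = v) (σ : Bool)
    (hσ : ∀ c : φ.OuterCorner K, X.cornerVertex c.1 = v → ∀ b,
      (X.linkStart (c.1, b)).1 ∈ (φ.preimage K).essentialPart.edges →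
        (φ.dart (X.linkStart (c.1, b))).2 = σ) :
    (φ.zeroCorners hL A v).ncard < (φ.outerDarts K v).ncard := by
  obtain ⟨h1, h2⟩ := zeroCorners_ncard_add_one_le hφ hfree hA (v := v)
    (P := {(⟨y, Or.inr rfl⟩, σ)}) (by simp) (fun c hc b => by
      by_cases h : (X.linkStart (c.1, b)).1 ∈ (φ.preimage K).essentialPart.edges
      · left
        rw [foldDart_of_mem h, hσ c hc b h]
        simp
      · exact Or.inr h) (Or.inl (by simp))
  have h3 : ¬ _ := fun h => h2 h c0 hc0
  rw [Finset.card_singleton] at h1 h3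
  omega

/-- The estimate at a vertex of the essential part. -/
theorem zeroCorners_le_outerDarts (hφ : φ.IsImmersion)
    (hA : (L.fold hL K y).SatisfiesColoringTest A)
    (hsep : ¬ (L.fold hL K y).SameComponentLk0 A
      (⟨y, Or.inr rfl⟩, true) (⟨y, Or.inr rfl⟩, false)) (v : X.V) :
    (φ.zeroCorners hL A v).ncard ≤ (φ.outerDarts K v).ncard := by
  classical
  set N := (φ.outerDarts K v).toFinite.toFinset with hN
  set Z := (φ.zeroCorners hL A v).toFinite.toFinset with hZ
  rw [Set.ncard_eq_toFinset_card _, Set.ncard_eq_toFinset_card _, ← hN, ← hZ]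
  set Es := Z.image (φ.foldCorner hL K y) with hEs
  -- Both ends of `y` are included as vertices, whether or not they occur; this makes the separation
  -- hypothesis applicable.
  set Q : Finset (L.fold hL K y).Dart :=
    {(⟨y, Or.inr rfl⟩, true), (⟨y, Or.inr rfl⟩, false)} with hQ
  set Vs := N.image (φ.foldDart hL K y) ∪ Q with hVs
  have memZ : ∀ c, c ∈ Z ↔ X.cornerVertex c.1 = v ∧ A.ω (φ.foldCorner hL K y c) = 0 := by
    simp [hZ, zeroCorners]
  have hEcard : Es.card = Z.card := Finset.card_image_of_injOn fun c hc c' hc' h =>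
    hφ.foldCorner_inj hL y (((memZ c).1 hc).1.trans ((memZ c').1 hc').1.symm) h
  have hQc : Q.card = 2 :=
    Finset.card_pair fun h => absurd (congrArg Prod.snd h) (by simp)
  have hVcard : Vs.card ≤ N.card + 2 := by
    rw [← hQc]
    exact (Finset.card_union_le _ _).trans (Nat.add_le_add_right Finset.card_image_le _)
  have hQm : ∀ b, ((⟨y, Or.inr rfl⟩, b) : (L.fold hL K y).Dart) ∈ Vs := by
    intro b
    refine Finset.mem_union_right _ ?_
    cases b <;> simp [hQ]
  obtain ⟨h1, h2⟩ := hA.isForest.card_add_one_le (Es := Es) (Vs := Vs) (fun c hc => by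
      obtain ⟨c', hc', rfl⟩ := Finset.mem_image.1 hc
      exact ((memZ _).1 hc').2) (fun c hc b => by
      obtain ⟨c', hc', rfl⟩ := Finset.mem_image.1 hc
      rw [linkStart_foldCorner]
      by_cases h : (X.linkStart (c'.1, b == φ.orient c'.1.1)).1 ∈
          (φ.preimage K).essentialPart.edges
      · rw [foldDart_of_mem h]
        exact hQm _
      · refine Finset.mem_union_left _ (Finset.mem_image_of_mem _ ?_)
        simp only [hN, Set.Finite.mem_toFinset]
        exact ⟨(init_linkStart _ _).trans ((memZ _).1 hc').1, h⟩) ⟨_, hQm true⟩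
  -- Failure would make the forest connected on a vertex set containing `y⁺` and `y⁻`; `Joined` for
  -- `linkStart` is `SameComponentLk0` by definition.
  by_contra hlt
  exact hsep (h2 (by omega) _ (hQm true) _ (hQm false))

/-- The estimate at a vertex outside the essential part. -/
theorem zeroCorners_add_two_le (hφ : φ.IsImmersion) (hfree : ∀ e, ¬ X.IsFreeEdge e)
    (hfreeV : ∀ v, ¬ X.IsFreeVertex v) (hX : X.IsConnected) (hp : ¬ X.IsPoint)
    (hA : (L.fold hL K y).SatisfiesColoringTest A) {v : X.V}
    (hv : v ∉ (φ.preimage K).essentialPart.verts) :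
    (φ.zeroCorners hL A v).ncard + 2 ≤ (φ.outerDarts K v).ncard := by
  classical
  have hout : ∀ d : X.Dart, X.init d = v → d.1 ∉ (φ.preimage K).essentialPart.edges := by
    rintro d rfl h
    apply hv
    unfold DirGraph.init
    split_ifs
    · exact (φ.preimage K).essentialPart.src_mem _ h
    · exact (φ.preimage K).essentialPart.tgt_mem _ h
  obtain ⟨d, hd⟩ := exists_init_eq hX hp v
  obtain ⟨h1, h2⟩ := zeroCorners_ncard_add_one_le hφ hfree hA (v := v)
    (P := ∅) (by simp) (fun c hc b => Or.inr (hout _ ((init_linkStart _ _).trans hc)))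
    (Or.inr ⟨d, hd, hout d hd⟩)
  rw [Finset.card_empty, add_zero] at h1 h2
  by_contra hlt
  -- Equality excludes outer corners at `v`, leaving a single dart with no 2-cell over its edge: a
  -- free vertex.
  have h3 := h2 (by omega)
  have hZ : φ.zeroCorners hL A v = ∅ := Set.eq_empty_of_forall_notMem fun c hc => h3 c hc.1
  rw [hZ, Set.ncard_empty] at h1 hlt
  obtain ⟨d', hd'⟩ := Set.ncard_eq_one.1 (le_antisymm (by omega) h1)
  have huniq : ∀ d'', X.init d'' = v ↔ d'' = d' := by
    intro d''
    have h4 := Set.ext_iff.1 hd' d''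
    exact ⟨fun h => h4.1 ⟨h, hout _ h⟩, fun h => (h4.2 h).1⟩
  refine hfreeV v ⟨d', huniq, fun c hc => ?_⟩
  have hl := linkStart_sideLink hc
  have hv' := (huniq d').2 rfl
  exact h3 ⟨(X.sideLink d' c).1, face_notMem_of_linkStart (by rw [hl]; exact hout _ hv')⟩
    ((init_linkStart _ (X.sideLink d' c).2).symm.trans ((congrArg X.init hl).trans hv'))

end CombMap

end TwoComplex

/-! ### Global count: combinatorial Gauss-Bonnet -/

namespace TwoComplex

variable {X L : TwoComplex.{u}}

theorem Subcomplex.eulerChar_toComplex (S : X.Subcomplex) :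
    S.toComplex.eulerChar = (S.verts.ncard : ℤ) - S.edges.ncard + S.faces.ncard := rfl

/-- With angles 0 and 1 the curvature is 2 minus the number of zero corners. -/
theorem two_le_card_zero {A : L.ZeroOneAngles} {f : L.F} (h : L.curvature A f ≤ 0) :
    2 ≤ (Finset.univ.filter fun i : ZMod (L.len f) => A.ω ⟨f, i⟩ = 0).card := by
  have h1 : ∀ i : ZMod (L.len f), A.ω ⟨f, i⟩ = 1 - if A.ω ⟨f, i⟩ = 0 then 1 else 0 := by
    intro i
    rcases A.zero_or_one ⟨f, i⟩ with h | h <;> simp [h]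
  unfold curvature at h
  rw [Finset.sum_congr rfl fun i _ => h1 i, Finset.sum_sub_distrib, Finset.sum_boole] at h
  simp only [Finset.sum_const, Finset.card_univ, ZMod.card, nsmul_eq_mul, mul_one] at h
  omega

namespace CombMap

variable {φ : CombMap X L} {hL : L.IsStandard} {K : L.Subcomplex} {y : L.E}
  {A : (L.fold hL K y).ZeroOneAngles}

theorem exists_foldCorner_eq {f : X.F} (hf : φ.face f ∉ K.faces)
    (j : ZMod ((L.fold hL K y).len ⟨φ.face f, hf⟩)) :
    ∃ c : φ.OuterCorner K, c.1.1 = f ∧ φ.foldCorner hL K y c = ⟨⟨φ.face f, hf⟩, j⟩ := by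
  cases ho : φ.orient f
  -- A reflection sends the corner after side `i` to the corner after the image of side `i + 1`,
  -- hence the shift.
  · exact ⟨⟨⟨f, (φ.sideMap f).symm j - 1⟩, hf⟩, rfl, by
      simp only [foldCorner, corner, ho, Bool.false_eq_true, if_false, sub_add_cancel]
      exact congrArg (Sigma.mk _) ((φ.sideMap f).apply_symm_apply j)⟩
  · exact ⟨⟨⟨f, (φ.sideMap f).symm j⟩, hf⟩, rfl, by
      simp only [foldCorner, corner, ho, if_true]
      exact congrArg (Sigma.mk _) ((φ.sideMap f).apply_symm_apply j)⟩

/-- The excess of outer darts over outer corners of angle zero at a vertex. -/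
noncomputable def excess (φ : CombMap X L) {hL : L.IsStandard} {K : L.Subcomplex} {y : L.E}
    (A : (L.fold hL K y).ZeroOneAngles) (v : X.V) : ℤ :=
  (φ.outerDarts K v).ncard - (φ.zeroCorners hL A v).ncard

theorem two_mul_compl_faces_le [Fintype X.V] [Finite X.E] [Finite X.F]
     (hA : (L.fold hL K y).SatisfiesColoringTest A) :
    2 * ((φ.preimage K).facesᶜ).ncard ≤ ∑ v : X.V, (φ.zeroCorners hL A v).ncard := by
  classical
  have := Fintype.ofFinite X.F
  have := Fintype.ofFinite (φ.OuterCorner K)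
  set Z : Finset (φ.OuterCorner K) :=
    Finset.univ.filter fun c => A.ω (φ.foldCorner hL K y c) = 0 with hZ
  have h1 : Z.card = ∑ v : X.V, (φ.zeroCorners hL A v).ncard := by
    rw [Finset.card_eq_sum_card_fiberwise (f := fun c => X.cornerVertex c.1) (t := Finset.univ)
      (fun _ _ => Finset.mem_coe.2 (Finset.mem_univ _))]
    refine Finset.sum_congr rfl fun v _ => ?_
    rw [← Set.ncard_coe_finset]
    congr 1
    ext c
    simp [hZ, zeroCorners, and_comm]
  have h2 : Z.card = ∑ f ∈ (φ.preimage K).facesᶜ.toFinset, (Z.filter fun c => c.1.1 = f).card :=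
    Finset.card_eq_sum_card_fiberwise (f := fun c : φ.OuterCorner K => c.1.1) fun c _ =>
      Finset.mem_coe.2 (Set.mem_toFinset.2 c.2)
  rw [← h1, h2, mul_comm, Set.ncard_eq_toFinset_card', ← smul_eq_mul]
  refine Finset.card_nsmul_le_sum _ _ _ fun f hf => ?_
  have hf' : φ.face f ∉ K.faces := Set.mem_toFinset.1 hf
  refine (two_le_card_zero (hA.1 ⟨φ.face f, hf'⟩)).trans ?_
  choose g hg1 hg2 using exists_foldCorner_eq (φ := φ) (hL := hL) (y := y) hf'
  refine Finset.card_le_card_of_injOn g (fun j hj => ?_) fun j _ j' _ h => ?_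
  · have hj' : A.ω ⟨⟨φ.face f, hf'⟩, j⟩ = 0 := (Finset.mem_filter.1 hj).2
    refine Finset.mem_coe.2
      (Finset.mem_filter.2 ⟨Finset.mem_filter.2 ⟨Finset.mem_univ _, ?_⟩, hg1 j⟩)
    rw [hg2, hj']
  · have h3 := hg2 j
    rw [h, hg2 j'] at h3
    exact (eq_of_heq (Sigma.mk.inj h3).2).symm

theorem sum_outerDarts [Fintype X.V] [Finite X.E] :
    ∑ v : X.V, (φ.outerDarts K v).ncard =
      2 * ((φ.preimage K).essentialPart.edgesᶜ).ncard := by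
  classical
  have := Fintype.ofFinite X.E
  set N : Finset X.Dart := ((φ.preimage K).essentialPart.edgesᶜ).toFinset ×ˢ Finset.univ with hN
  have h1 : N.card = ∑ v : X.V, (φ.outerDarts K v).ncard := by
    rw [Finset.card_eq_sum_card_fiberwise (f := fun d => X.init d) (t := Finset.univ)
      (fun _ _ => Finset.mem_coe.2 (Finset.mem_univ _))]
    refine Finset.sum_congr rfl fun v _ => ?_
    rw [← Set.ncard_coe_finset]
    congr 1
    ext c
    simp [hN, outerDarts, and_comm]
  rw [← h1, hN, Finset.card_product, Set.ncard_eq_toFinset_card']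
  simp [mul_comm]

/-- The combinatorial Gauss-Bonnet estimate. -/
theorem two_mul_eulerChar_add_le [Fintype X.V] [Finite X.E] [Finite X.F]
     (hA : (L.fold hL K y).SatisfiesColoringTest A)
    (hout : ∀ v ∉ (φ.preimage K).essentialPart.verts, 2 ≤ φ.excess A v) :
    2 * X.eulerChar + ∑ v ∈ (φ.preimage K).essentialPart.verts.toFinite.toFinset, φ.excess A v ≤
      2 * (φ.preimage K).essentialPart.toComplex.eulerChar := by
  classical
  have hF := two_mul_compl_faces_le (φ := φ) hA
  have hE := sum_outerDarts (φ := φ) (K := K)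
  have hsum : ∑ v : X.V, φ.excess A v = 2 * (((φ.preimage K).essentialPart.edgesᶜ).ncard : ℤ) -
      ∑ v : X.V, ((φ.zeroCorners hL A v).ncard : ℤ) := by
    unfold excess
    rw [Finset.sum_sub_distrib, ← Nat.cast_sum, hE]
    push_cast
    ring
  set S := (φ.preimage K).essentialPart with hS
  have hsplit := Finset.sum_add_sum_compl S.verts.toFinite.toFinset (fun v => φ.excess A v)
  have hV : 2 * (S.vertsᶜ.ncard : ℤ) ≤ ∑ v ∈ S.verts.toFinite.toFinsetᶜ, φ.excess A v := by
    have h3 : S.vertsᶜ.ncard = S.verts.toFinite.toFinsetᶜ.card := by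
      rw [← Set.ncard_coe_finset]
      simp
    rw [h3, mul_comm, ← nsmul_eq_mul]
    exact Finset.card_nsmul_le_sum _ _ _ fun v hv => hout v (by simpa using hv)
  have cV := Set.ncard_add_ncard_compl S.verts
  have cE := Set.ncard_add_ncard_compl S.edges
  have cF := Set.ncard_add_ncard_compl S.faces
  have hSF : S.faces = (φ.preimage K).faces := rfl
  rw [← hSF] at hF
  have hF' : 2 * (S.facesᶜ.ncard : ℤ) ≤ ∑ v : X.V, ((φ.zeroCorners hL A v).ncard : ℤ) := by
    exact_mod_cast hF
  rw [Subcomplex.eulerChar_toComplex, eulerChar, ← cV, ← cE, ← cF]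
  push_cast
  linarith

end CombMap

end TwoComplex

namespace TwoComplex

variable {X L : TwoComplex.{u}}

/-! ### Connected subcomplexes -/

namespace Subcomplex

/-- Two vertices are the ends of an edge of `S`. -/
def Adj (S : X.Subcomplex) (a b : X.V) : Prop := ∃ e ∈ S.edges, X.src e = a ∧ X.tgt e = b

/-- The subcomplex is non-empty, and any two of its vertices are joined by an edge path in it. -/
def IsConn (S : X.Subcomplex) : Prop :=
  S.verts.Nonempty ∧ ∀ v ∈ S.verts, ∀ w ∈ S.verts, Relation.EqvGen S.Adj v w

theorem IsConn.toComplex {S : X.Subcomplex} (hS : S.IsConn) : S.toComplex.IsConnected := by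
  -- The alternative `v = w` covers constant paths at vertices outside `S`.
  have key : ∀ v w, Relation.EqvGen S.Adj v w → v = w ∨ ∃ (hv : v ∈ S.verts) (hw : w ∈ S.verts),
      Relation.EqvGen (fun a b => ∃ e, S.toComplex.src e = a ∧ S.toComplex.tgt e = b)
        (⟨v, hv⟩ : S.toComplex.V) ⟨w, hw⟩ := by
    intro v w h
    induction h with
    | rel v w h =>
      obtain ⟨e, he, rfl, rfl⟩ := h
      exact Or.inr ⟨S.src_mem e he, S.tgt_mem e he, Relation.EqvGen.rel _ _ ⟨⟨e, he⟩, rfl, rfl⟩⟩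
    | refl => exact Or.inl rfl
    | symm _ _ _ ih =>
      rcases ih with rfl | ⟨hv, hw, h⟩
      · exact Or.inl rfl
      · exact Or.inr ⟨hw, hv, h.symm⟩
    | trans _ _ _ _ _ ih1 ih2 =>
      rcases ih1 with rfl | ⟨hv, hw, h⟩
      · exact ih2
      · rcases ih2 with rfl | ⟨hv', hw', h'⟩
        · exact Or.inr ⟨hv, hw, h⟩
        · exact Or.inr ⟨hv, hw', h.trans _ _ _ h'⟩
  obtain ⟨⟨v, hv⟩, hc⟩ := hS
  refine ⟨⟨⟨v, hv⟩⟩, ?_⟩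
  rintro ⟨a, ha⟩ ⟨b, hb⟩
  rcases key a b (hc a ha b hb) with rfl | ⟨_, _, h⟩
  · exact Relation.EqvGen.refl _
  · exact h

theorem eqvGen_init_term {S : X.Subcomplex} {d : X.Dart} (hd : d.1 ∈ S.edges) :
    Relation.EqvGen S.Adj (X.init d) (X.term d) := by
  obtain ⟨e, b⟩ := d
  cases b
  · exact (Relation.EqvGen.rel _ _ ⟨e, hd, rfl, rfl⟩).symm
  · exact Relation.EqvGen.rel _ _ ⟨e, hd, rfl, rfl⟩

theorem eqvGen_init_side {S : X.Subcomplex} {f : X.F} {i : ZMod (X.len f)} (n : ℕ)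
    (h : ∀ k < n, (X.side f (i + k)).1 ∈ S.edges) :
    Relation.EqvGen S.Adj (X.init (X.side f i)) (X.init (X.side f (i + n))) := by
  induction n with
  | zero => simpa using Relation.EqvGen.refl _
  | succ n ih =>
    refine (ih fun k hk => h k (by omega)).trans _ _ _ ?_
    have h1 := eqvGen_init_term (h n (by omega))
    rw [X.closed] at h1
    rw [Nat.cast_succ, ← add_assoc]
    exact h1

theorem init_mem {S : X.Subcomplex} {d : X.Dart} (hd : d.1 ∈ S.edges) : X.init d ∈ S.verts := by
  unfold DirGraph.init
  split_ifs
  · exact S.src_mem _ hd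
  · exact S.tgt_mem _ hd

theorem coe_init_toComplex (S : X.Subcomplex) (d : S.toComplex.Dart) :
    (S.toComplex.init d : S.verts).1 = X.init (d.1.1, d.2) := by
  obtain ⟨e, b⟩ := d
  cases b <;> rfl

/-- The subcomplex obtained by collapsing a free edge. -/
def eraseFreeEdge (S : X.Subcomplex) (e : X.E) (f : X.F)
    (h : ∀ f' ∈ S.faces, ∀ i, (X.side f' i).1 = e → f' = f) : X.Subcomplex where
  verts := S.verts
  edges := S.edges \ {e}
  faces := S.faces \ {f}
  src_mem e' he' := S.src_mem e' he'.1
  tgt_mem e' he' := S.tgt_mem e' he'.1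
  side_mem f' hf' i := ⟨S.side_mem f' hf'.1 i, fun hi => hf'.2 (h f' hf'.1 i hi)⟩

/-- The subcomplex obtained by collapsing a free vertex. -/
def eraseFreeVertex (S : X.Subcomplex) (d : X.Dart)
    (h : ∀ d' : X.Dart, d'.1 ∈ S.edges → X.init d' = X.init d → d' = d)
    (hf : ∀ f ∈ S.faces, ∀ i, (X.side f i).1 ≠ d.1) : X.Subcomplex where
  verts := S.verts \ {X.init d}
  edges := S.edges \ {d.1}
  faces := S.faces
  src_mem e he := ⟨S.src_mem e he.1, fun hv => he.2 (congrArg Prod.fst (h (e, true) he.1 hv))⟩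
  tgt_mem e he := ⟨S.tgt_mem e he.1, fun hv => he.2 (congrArg Prod.fst (h (e, false) he.1 hv))⟩
  side_mem f hf' i := ⟨S.side_mem f hf' i, hf f hf' i⟩

end Subcomplex

/-! ### Restricted maps, height functions and collapses -/

/-- The sign of a direction. -/
def sgn (b : Bool) : ℤ := if b = true then 1 else -1

theorem sgn_not (b : Bool) : sgn (!b) = -sgn b := by cases b <;> rfl

theorem term_rev (d : X.Dart) : X.term (X.rev d) = X.init d := by
  simp [DirGraph.term, DirGraph.rev]

theorem eq_or_eq_rev {d d' : X.Dart} (h : d'.1 = d.1) : d' = d ∨ d' = X.rev d := by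
  obtain ⟨e, b⟩ := d
  obtain ⟨e', b'⟩ := d'
  obtain rfl : e' = e := h
  cases b <;> cases b' <;> simp [DirGraph.rev]

namespace CombMap

variable (φ : CombMap X L)

/-- The subcomplex `S` is mapped into `K`. -/
def MapsInto (S : X.Subcomplex) (K : L.Subcomplex) : Prop :=
  (∀ v ∈ S.verts, φ.vert v ∈ K.verts) ∧ (∀ e ∈ S.edges, φ.edge e ∈ K.edges) ∧
    ∀ f ∈ S.faces, φ.face f ∈ K.faces

variable {φ} in
/-- The restriction of a combinatorial map to subcomplexes. -/
def restrict {S : X.Subcomplex} {K : L.Subcomplex} (h : φ.MapsInto S K) :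
    CombMap S.toComplex K.toComplex where
  vert v := ⟨φ.vert v.1, h.1 v.1 v.2⟩
  dart d := (⟨(φ.dart (d.1.1, d.2)).1, by rw [φ.dart_fst]; exact h.2.1 d.1.1 d.1.2⟩,
    (φ.dart (d.1.1, d.2)).2)
  face f := ⟨φ.face f.1, h.2.2 f.1 f.2⟩
  orient f := φ.orient f.1
  sideMap f := φ.sideMap f.1
  init_dart d := by
    apply Subtype.ext
    rw [Subcomplex.coe_init_toComplex]
    refine (φ.init_dart _).trans ?_
    rw [← Subcomplex.coe_init_toComplex]
  dart_rev d := by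
    have h1 := φ.dart_rev (d.1.1, d.2)
    have h2 : (φ.dart (X.rev (d.1.1, d.2))).1 = (L.rev (φ.dart (d.1.1, d.2))).1 := by rw [h1]
    have h3 : (φ.dart (X.rev (d.1.1, d.2))).2 = (L.rev (φ.dart (d.1.1, d.2))).2 := by rw [h1]
    exact Prod.ext (Subtype.ext h2) h3
  sideMap_add_one f i := φ.sideMap_add_one f.1 i
  side_sideMap f i := by
    have h1 := φ.side_sideMap f.1 i
    refine Prod.ext (Subtype.ext ((congrArg Prod.fst h1).trans ?_))
      ((congrArg Prod.snd h1).trans ?_)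
    · cases φ.orient f.1 <;> rfl
    · cases φ.orient f.1 <;> rfl

variable {φ}

theorem IsImmersion.restrict (hφ : φ.IsImmersion) {S : X.Subcomplex} {K : L.Subcomplex}
    (h : φ.MapsInto S K) : (restrict h).IsImmersion := by
  constructor
  · rintro ⟨⟨e, he⟩, b⟩ ⟨⟨e', he'⟩, b'⟩ h1 h2
    have h3 := congrArg Subtype.val h1
    rw [Subcomplex.coe_init_toComplex, Subcomplex.coe_init_toComplex] at h3
    have h4 := hφ.1 _ _ h3
      (Prod.ext (congrArg (fun p => p.1.1) h2) (congrArg (fun p => p.2) h2))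
    exact Prod.ext (Subtype.ext (congrArg (fun p : X.Dart => p.1) h4))
      (congrArg (fun p : X.Dart => p.2) h4)
  · rintro ⟨⟨f, hf⟩, i⟩ ⟨⟨f', hf'⟩, i'⟩ h1 h2
    have h3 := congrArg Subtype.val h1
    unfold cornerVertex at h3
    rw [Subcomplex.coe_init_toComplex, Subcomplex.coe_init_toComplex] at h3
    have h4 := hφ.2 ⟨f, i⟩ ⟨f', i'⟩ h3
      (congrArg (fun c : K.toComplex.Corner => (⟨c.1.1, c.2⟩ : L.Corner)) h2)
    obtain ⟨rfl, h4⟩ := Sigma.mk.inj h4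
    exact congrArg (Sigma.mk _) (eq_of_heq h4)

/-- The function `h` on vertices increases by one along every edge of `S`, where edges are directed
by means of `φ`. -/
def IsHeight (φ : CombMap X L) (S : X.Subcomplex) (h : X.V → ℤ) : Prop :=
  ∀ d : X.Dart, d.1 ∈ S.edges → h (X.term d) = h (X.init d) + sgn (φ.dart d).2

theorem height_rev {h : X.V → ℤ} {d d' : X.Dart} (hdd : d'.1 = d.1)
    (hd : h (X.term d) = h (X.init d) + sgn (φ.dart d).2) :
    h (X.term d') = h (X.init d') + sgn (φ.dart d').2 := by
  rcases eq_or_eq_rev hdd with rfl | rfl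
  · exact hd
  · have h1 : X.init (X.rev d) = X.term d := rfl
    have h2 : (L.rev (φ.dart d)).2 = !(φ.dart d).2 := rfl
    rw [term_rev, h1, φ.dart_rev, h2, sgn_not, hd]
    ring

theorem sum_sgn_side (f : X.F) (hf : L.expSum (φ.face f) = 0) :
    ∑ i : ZMod (X.len f), sgn (φ.dart (X.side f i)).2 = 0 := by
  unfold expSum at hf
  rw [← Equiv.sum_comp (φ.sideMap f)] at hf
  simp only [φ.side_sideMap] at hf
  cases ho : φ.orient f <;> simp only [ho, Bool.false_eq_true, if_true, if_false] at hf
  · rw [← neg_eq_zero, ← Finset.sum_neg_distrib, ← hf]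
    exact Finset.sum_congr rfl fun i _ => (sgn_not _).symm
  · exact hf

theorem sum_height_side (h : X.V → ℤ) (f : X.F) :
    ∑ i : ZMod (X.len f), (h (X.term (X.side f i)) - h (X.init (X.side f i))) = 0 := by
  rw [Finset.sum_sub_distrib, sub_eq_zero]
  simp only [X.closed]
  exact Equiv.sum_comp (Equiv.addRight (1 : ZMod (X.len f))) fun i => h (X.init (X.side f i))

/-- Around the removed 2-cell the height differences telescope to 0 and the signs sum to 0. All
sides but the free one already match, so the free one does too. -/
theorem IsHeight.of_eraseFreeEdge {S : X.Subcomplex} {c : X.Corner}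
    (hc : ∀ f ∈ S.faces, ∀ i, (X.side f i).1 = (X.side c.1 c.2).1 → (⟨f, i⟩ : X.Corner) = c)
    (hcS : c.1 ∈ S.faces) (hexp : L.expSum (φ.face c.1) = 0) {h : X.V → ℤ}
    (hh : φ.IsHeight (S.eraseFreeEdge (X.side c.1 c.2).1 c.1
      fun f hf i hi => congrArg Sigma.fst (hc f hf i hi)) h) : φ.IsHeight S h := by
  intro d hd
  by_cases hde : d.1 = (X.side c.1 c.2).1
  swap
  · exact hh d ⟨hd, hde⟩
  refine height_rev hde ?_
  have h1 := sum_height_side h c.1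
  have h2 := sum_sgn_side c.1 hexp
  have h3 : ∑ i : ZMod (X.len c.1), (h (X.term (X.side c.1 i)) - h (X.init (X.side c.1 i)) -
      sgn (φ.dart (X.side c.1 i)).2) = 0 := by
    rw [Finset.sum_sub_distrib, h1, h2, sub_zero]
  rw [Finset.sum_eq_single c.2 (fun i _ hi => by
    rw [hh (X.side c.1 i) ⟨S.side_mem _ hcS _, fun hi' => hi ?_⟩]
    · ring
    · have := hc c.1 hcS i hi'
      obtain ⟨f, j⟩ := c
      simpa using this) (by simp)] at h3
  linarith

end CombMap

/-- The rest of the boundary path of the removed 2-cell joins the ends of the free edge. -/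
theorem Subcomplex.IsConn.eraseFreeEdge {S : X.Subcomplex} (hS : S.IsConn) {c : X.Corner}
    (hc : ∀ f ∈ S.faces, ∀ i, (X.side f i).1 = (X.side c.1 c.2).1 → (⟨f, i⟩ : X.Corner) = c)
    (hcS : c.1 ∈ S.faces) : (S.eraseFreeEdge (X.side c.1 c.2).1 c.1
      fun f hf i hi => congrArg Sigma.fst (hc f hf i hi)).IsConn := by
  set S' := S.eraseFreeEdge (X.side c.1 c.2).1 c.1
    fun f hf i hi => congrArg Sigma.fst (hc f hf i hi)
  have hside : Relation.EqvGen S'.Adj (X.term (X.side c.1 c.2)) (X.init (X.side c.1 c.2)) := by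
    have hlen : 1 ≤ X.len c.1 := Nat.one_le_iff_ne_zero.2 (NeZero.ne _)
    have h1 := Subcomplex.eqvGen_init_side (S := S') (i := c.2 + 1) (X.len c.1 - 1) fun k hk => by
      refine ⟨S.side_mem _ hcS _, fun h => ?_⟩
      have h2 := hc c.1 hcS _ h
      have h3 : c.2 + 1 + (k : ZMod (X.len c.1)) = c.2 := by
        obtain ⟨f, j⟩ := c
        simpa using h2
      have h4 : ((k + 1 : ℕ) : ZMod (X.len c.1)) = 0 := by
        push_cast
        linear_combination h3
      rw [ZMod.natCast_eq_zero_iff] at h4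
      have := Nat.le_of_dvd (by omega) h4
      omega
    rw [X.closed]
    have h5 : c.2 + 1 + ((X.len c.1 - 1 : ℕ) : ZMod (X.len c.1)) = c.2 := by
      rw [Nat.cast_sub hlen]
      simp
    rwa [h5] at h1
  have hstep : ∀ a b, Relation.EqvGen S.Adj a b → Relation.EqvGen S'.Adj a b := by
    intro a b h
    induction h with
    | rel a b h =>
      obtain ⟨e, he, rfl, rfl⟩ := h
      by_cases hee : e = (X.side c.1 c.2).1
      · subst hee
        revert hside
        unfold DirGraph.term DirGraph.init DirGraph.rev
        cases (X.side c.1 c.2).2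
        · exact fun h => h
        · exact fun h => h.symm
      · exact Relation.EqvGen.rel _ _ ⟨e, ⟨he, hee⟩, rfl, rfl⟩
    | refl => exact Relation.EqvGen.refl _
    | symm _ _ _ ih => exact ih.symm
    | trans _ _ _ _ _ ih1 ih2 => exact ih1.trans _ _ _ ih2
  exact ⟨hS.1, fun v hv w hw => hstep v w (hS.2 v hv w hw)⟩

theorem Subcomplex.IsConn.eraseFreeVertex {S : X.Subcomplex} (hS : S.IsConn) {d : X.Dart}
    (hd : d.1 ∈ S.edges)
    (h : ∀ d' : X.Dart, d'.1 ∈ S.edges → X.init d' = X.init d → d' = d)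
    (hf : ∀ f ∈ S.faces, ∀ i, (X.side f i).1 ≠ d.1) : (S.eraseFreeVertex d h hf).IsConn := by
  classical
  set S' := S.eraseFreeVertex d h hf
  have hterm : X.term d ≠ X.init d := fun ht => by
    have := congrArg Prod.snd (h (X.rev d) hd ht)
    simp [DirGraph.rev] at this
  -- Retraction pushing the free vertex along its edge; it carries paths of `S` to paths of `S'`.
  let ρ : X.V → X.V := fun v => if v = X.init d then X.term d else v
  have hstep : ∀ a b, Relation.EqvGen S.Adj a b → Relation.EqvGen S'.Adj (ρ a) (ρ b) := by
    intro a b hab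
    induction hab with
    | rel a b hab =>
      obtain ⟨e, he, rfl, rfl⟩ := hab
      by_cases hee : e = d.1
      · have key : ρ (X.init d) = ρ (X.term d) := by simp [ρ]
        have : ρ (X.src e) = ρ (X.tgt e) := by
          obtain ⟨e', b⟩ := d
          obtain rfl : e = e' := hee
          cases b
          · exact key.symm
          · exact key
        rw [this]
        exact Relation.EqvGen.refl _
      · have h1 : X.src e ≠ X.init d := fun hv => hee (congrArg Prod.fst (h (e, true) he hv))
        have h2 : X.tgt e ≠ X.init d := fun hv => hee (congrArg Prod.fst (h (e, false) he hv))
        simp only [ρ, h1, h2, if_false]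
        exact Relation.EqvGen.rel _ _ ⟨e, ⟨he, hee⟩, rfl, rfl⟩
    | refl => exact Relation.EqvGen.refl _
    | symm _ _ _ ih => exact ih.symm
    | trans _ _ _ _ _ ih1 ih2 => exact ih1.trans _ _ _ ih2
  refine ⟨⟨X.term d, init_mem (d := X.rev d) hd, hterm⟩, fun v hv w hw => ?_⟩
  have := hstep v w (hS.2 v hv.1 w hw.1)
  have hv' : v ≠ X.init d := hv.2
  have hw' : w ≠ X.init d := hw.2
  simpa only [ρ, hv', hw', if_false] using this

theorem IsPoint.eulerChar_eq_one (hX : X.IsPoint) : X.eulerChar = 1 := by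
  obtain ⟨h1, h2, h3, h4⟩ := hX
  simp [TwoComplex.eulerChar]

namespace CombMap

variable {φ : CombMap X L} {K : L.Subcomplex}

theorem IsHeight.update_of_eraseFreeVertex [DecidableEq X.V] {S : X.Subcomplex} {d : X.Dart}
    (hd : d.1 ∈ S.edges)
    (hu : ∀ d' : X.Dart, d'.1 ∈ S.edges → X.init d' = X.init d → d' = d)
    (hf : ∀ f ∈ S.faces, ∀ i, (X.side f i).1 ≠ d.1) {h : X.V → ℤ}
    (hh : φ.IsHeight (S.eraseFreeVertex d hu hf) h) :
    φ.IsHeight S (Function.update h (X.init d) (h (X.term d) - sgn (φ.dart d).2)) := by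
  have hterm : X.term d ≠ X.init d := fun ht => by
    have := congrArg Prod.snd (hu (X.rev d) hd ht)
    simp [DirGraph.rev] at this
  intro d' hd'
  by_cases hdd : d'.1 = d.1
  · refine height_rev hdd ?_
    rw [Function.update_self, Function.update_of_ne hterm]
    ring
  · have h1 : X.init d' ≠ X.init d := fun hv => hdd (congrArg Prod.fst (hu d' hd' hv))
    have h2 : X.term d' ≠ X.init d := fun hv => by
      have h3 : (X.rev d').1 = d.1 := by rw [hu (X.rev d') hd' hv]
      exact hdd h3
    rw [Function.update_of_ne h1, Function.update_of_ne h2]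
    exact hh d' ⟨hd', hdd⟩

/-- A connected complex over a complex with collapsing non-positive immersion, all of whose
2-cells have exponent sum zero, has non-positive Euler characteristic, or it collapses to a point
and hence admits a height function. -/
theorem eulerChar_nonpos_or_exists_isHeight [Finite X.V] [Finite X.E] [Finite X.F]
    (hφ : φ.IsImmersion) (hK : ∀ f ∈ K.faces, L.expSum f = 0) (hKN : K.toComplex.CollapsingNPI)
    {S : X.Subcomplex} (hm : φ.MapsInto S K) (hS : S.IsConn) :
    S.toComplex.eulerChar ≤ 0 ∨ S.toComplex.eulerChar = 1 ∧ ∃ h, φ.IsHeight S h := by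
  classical
  induction hn : S.edges.ncard using Nat.strong_induction_on generalizing S with
  | _ n ih =>
  subst hn
  by_cases hfe : ∃ e, S.toComplex.IsFreeEdge e
  · obtain ⟨e, ⟨⟨f, hf⟩, i⟩, hi, hu⟩ := hfe
    set c : X.Corner := ⟨f, i⟩ with hc
    have hcu : ∀ f ∈ S.faces, ∀ i, (X.side f i).1 = (X.side c.1 c.2).1 →
        (⟨f, i⟩ : X.Corner) = c := by
      intro f' hf' i' hi'
      have h1 := hu ⟨⟨f', hf'⟩, i'⟩ (Subtype.ext (hi'.trans (congrArg Subtype.val hi)))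
      exact congrArg (fun c : S.toComplex.Corner => (⟨c.1.1, c.2⟩ : X.Corner)) h1
    have hce : (X.side c.1 c.2).1 ∈ S.edges := S.side_mem _ hf _
    have hE := Set.ncard_sdiff_singleton_add_one hce
    have hF := Set.ncard_sdiff_singleton_add_one hf
    set S' := S.eraseFreeEdge (X.side c.1 c.2).1 c.1
      fun f hf i hi => congrArg Sigma.fst (hcu f hf i hi) with hS'
    have hχ : S'.toComplex.eulerChar = S.toComplex.eulerChar := by
      rw [Subcomplex.eulerChar_toComplex, Subcomplex.eulerChar_toComplex, ← hE, ← hF]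
      change (S.verts.ncard : ℤ) - (S.edges \ {(X.side c.1 c.2).1}).ncard +
        (S.faces \ {f}).ncard = _
      push_cast
      ring
    have h1 := ih _ (by rw [← hE]; exact Nat.lt_succ_self _) (S := S')
      ⟨hm.1, fun e he => hm.2.1 e he.1, fun f hf => hm.2.2 f hf.1⟩ (hS.eraseFreeEdge hcu hf) rfl
    rw [hχ] at h1
    refine h1.imp_right fun ⟨h2, h, hh⟩ => ⟨h2, h, ?_⟩
    exact IsHeight.of_eraseFreeEdge hcu hf (hK _ (hm.2.2 f hf)) hh
  by_cases hfv : ∃ v, S.toComplex.IsFreeVertex v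
  · obtain ⟨v, ⟨⟨e, he⟩, b⟩, hd, hf⟩ := hfv
    set d : X.Dart := (e, b) with hdd
    have hu : ∀ d' : X.Dart, d'.1 ∈ S.edges → X.init d' = X.init d → d' = d := by
      intro d' hd' hv'
      have h1 := (hd (⟨d'.1, hd'⟩, d'.2)).1 (by
        rw [← (hd _).2 rfl]
        apply Subtype.ext
        rw [Subcomplex.coe_init_toComplex, Subcomplex.coe_init_toComplex]
        exact hv')
      exact congrArg (fun d : S.toComplex.Dart => ((d.1.1, d.2) : X.Dart)) h1
    have hf' : ∀ f ∈ S.faces, ∀ i, (X.side f i).1 ≠ d.1 := fun f hf' i hi =>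
      hf ⟨⟨f, hf'⟩, i⟩ (Subtype.ext hi)
    have hE := Set.ncard_sdiff_singleton_add_one (show d.1 ∈ S.edges from he)
    have hV := Set.ncard_sdiff_singleton_add_one
      (show X.init d ∈ S.verts from Subcomplex.init_mem he)
    set S' := S.eraseFreeVertex d hu hf' with hS'
    have hχ : S'.toComplex.eulerChar = S.toComplex.eulerChar := by
      rw [Subcomplex.eulerChar_toComplex, Subcomplex.eulerChar_toComplex, ← hE, ← hV]
      change ((S.verts \ {X.init d}).ncard : ℤ) - (S.edges \ {d.1}).ncard + S.faces.ncard = _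
      push_cast
      ring
    have h1 := ih _ (by rw [← hE]; exact Nat.lt_succ_self _) (S := S')
      ⟨fun v hv => hm.1 v hv.1, fun e he => hm.2.1 e he.1, hm.2.2⟩
      (hS.eraseFreeVertex he hu hf') rfl
    rw [hχ] at h1
    exact h1.imp_right fun ⟨h2, h, hh⟩ => ⟨h2, _, IsHeight.update_of_eraseFreeVertex he hu hf' hh⟩
  -- Nothing is left to collapse, so the hypothesis on `K` applies; on a point the zero height works
  -- vacuously.
  · push Not at hfe hfv
    refine (hKN S.toComplex (restrict hm) (hφ.restrict hm)
      ⟨inferInstanceAs (Finite S.verts), inferInstanceAs (Finite S.edges),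
        inferInstanceAs (Finite S.faces)⟩ hS.toComplex hfv hfe).imp_right
      fun hp => ⟨hp.eulerChar_eq_one, fun _ => 0, fun d hd => (hp.2.2.1.false ⟨d.1, hd⟩).elim⟩

end CombMap

end TwoComplex

namespace TwoComplex

variable {X L : TwoComplex.{u}}

/-! ### Components -/

namespace Subcomplex

/-- The class of a vertex under connectedness in `S`. -/
def cls (S : X.Subcomplex) (v : X.V) : Quot S.Adj := Quot.mk _ v

theorem cls_eq_iff {S : X.Subcomplex} {v w : X.V} :
    S.cls v = S.cls w ↔ Relation.EqvGen S.Adj v w :=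
  ⟨Quot.eqvGen_exact, Quot.eqvGen_sound⟩

theorem cls_init_side {S : X.Subcomplex} {f : X.F} (hf : f ∈ S.faces) (i j : ZMod (X.len f)) :
    S.cls (X.init (X.side f i)) = S.cls (X.init (X.side f j)) := by
  rw [cls_eq_iff]
  have h := eqvGen_init_side (S := S) (i := i) (j - i).val fun k _ => S.side_mem f hf _
  rwa [ZMod.natCast_zmod_val, add_sub_cancel] at h

theorem cls_term {S : X.Subcomplex} {d : X.Dart} (hd : d.1 ∈ S.edges) :
    S.cls (X.term d) = S.cls (X.init d) :=
  cls_eq_iff.2 (eqvGen_init_term hd).symm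

theorem cls_src {S : X.Subcomplex} {d : X.Dart} (hd : d.1 ∈ S.edges) :
    S.cls (X.src d.1) = S.cls (X.init d) := by
  obtain ⟨e, b⟩ := d
  cases b
  · exact cls_term (d := (e, false)) hd
  · rfl

/-- The component of `S` of a given class. -/
def component (S : X.Subcomplex) (q : Quot S.Adj) : X.Subcomplex where
  verts := {v ∈ S.verts | S.cls v = q}
  edges := {e ∈ S.edges | S.cls (X.src e) = q}
  faces := {f ∈ S.faces | S.cls (X.init (X.side f 0)) = q}
  src_mem e he := ⟨S.src_mem e he.1, he.2⟩
  tgt_mem e he := ⟨S.tgt_mem e he.1, (cls_term (d := (e, true)) he.1).trans he.2⟩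
  side_mem f hf i := ⟨S.side_mem f hf.1 i,
    (cls_src (S.side_mem f hf.1 i)).trans ((cls_init_side hf.1 i 0).trans hf.2)⟩

/-- A path in `S` never leaves its class, so all its edges lie in the component. -/
theorem isConn_component {S : X.Subcomplex} {q : Quot S.Adj}
    (hq : (S.component q).verts.Nonempty) : (S.component q).IsConn := by
  have key : ∀ v w, Relation.EqvGen S.Adj v w → S.cls v = S.cls w ∧
      (S.cls v = q → Relation.EqvGen (S.component q).Adj v w) := by
    intro v w h
    refine ⟨cls_eq_iff.2 h, ?_⟩
    induction h with
    | rel v w h =>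
      intro hv
      obtain ⟨e, he, rfl, rfl⟩ := h
      exact Relation.EqvGen.rel _ _ ⟨e, ⟨he, hv⟩, rfl, rfl⟩
    | refl => exact fun _ => Relation.EqvGen.refl _
    | symm _ _ h ih => exact fun hv => (ih ((cls_eq_iff.2 h).trans hv)).symm
    | trans _ _ _ h _ ih1 ih2 =>
      exact fun hv => (ih1 hv).trans _ _ _ (ih2 ((cls_eq_iff.2 h).symm.trans hv))
  exact ⟨hq, fun v hv w hw => (key v w (cls_eq_iff.1 (hv.2.trans hw.2.symm))).2 hv.2⟩

theorem ncard_eq_sum_fiber {α β : Type*} [Finite α] [Fintype β] (s : Set α) (g : α → β) :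
    s.ncard = ∑ b, {a ∈ s | g a = b}.ncard := by
  classical
  have := Fintype.ofFinite α
  rw [Set.ncard_eq_toFinset_card', Finset.card_eq_sum_card_fiberwise (f := g) (t := Finset.univ)
    (fun _ _ => Finset.mem_coe.2 (Finset.mem_univ _))]
  refine Finset.sum_congr rfl fun b _ => ?_
  rw [← Set.ncard_coe_finset]
  congr 1
  ext a
  simp

/-- Vertices outside `S` also have classes in `Quot S.Adj`; their components are empty and
contribute 0. -/
theorem eulerChar_eq_sum_component [Finite X.V] [Finite X.E] [Finite X.F] (S : X.Subcomplex)
    [Fintype (Quot S.Adj)] :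
    S.toComplex.eulerChar = ∑ q, (S.component q).toComplex.eulerChar := by
  simp only [eulerChar_toComplex]
  rw [Finset.sum_add_distrib, Finset.sum_sub_distrib, ncard_eq_sum_fiber S.verts S.cls,
    ncard_eq_sum_fiber S.edges (fun e => S.cls (X.src e)),
    ncard_eq_sum_fiber S.faces (fun f => S.cls (X.init (X.side f 0)))]
  push_cast
  rfl

theorem sum_verts_eq_sum_component [Finite X.V] (S : X.Subcomplex) [Fintype (Quot S.Adj)]
    (g : X.V → ℤ) : ∑ v ∈ S.verts.toFinite.toFinset, g v =
      ∑ q, ∑ v ∈ (S.component q).verts.toFinite.toFinset, g v := by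
  classical
  rw [← Finset.sum_fiberwise _ S.cls]
  refine Finset.sum_congr rfl fun q _ => Finset.sum_congr ?_ fun _ _ => rfl
  ext v
  simp [component]

/-- In an essential part, every vertex of a component lies on a 2-cell of this component. -/
theorem exists_face_of_mem_component {T : X.Subcomplex} {q : Quot T.essentialPart.Adj} {v : X.V}
    (hv : v ∈ (T.essentialPart.component q).verts) :
    ∃ f ∈ (T.essentialPart.component q).faces, ∃ i, ∃ b, v = X.init ((X.side f i).1, b) := by
  obtain ⟨⟨f, hf, i, hi⟩, hq⟩ := hv
  have hb : ∃ b, v = X.init ((X.side f i).1, b) := by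
    rcases hi with hi | hi
    · exact ⟨true, hi⟩
    · exact ⟨false, hi⟩
  obtain ⟨b, rfl⟩ := hb
  have hmem := T.essentialPart.side_mem f hf i
  have h1 := cls_src (S := T.essentialPart) (d := ((X.side f i).1, b)) hmem
  have h2 := cls_src (S := T.essentialPart) (d := X.side f i) hmem
  exact ⟨f, ⟨hf, (cls_init_side (S := T.essentialPart) hf 0 i).trans
    (h2.symm.trans (h1.trans hq))⟩, i, b, rfl⟩

theorem exists_face_of_edge_component {T : X.Subcomplex} {q : Quot T.essentialPart.Adj} {e : X.E}
    (he : e ∈ (T.essentialPart.component q).edges) :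
    ∃ f ∈ (T.essentialPart.component q).faces, ∃ i, (X.side f i).1 = e := by
  obtain ⟨⟨f, hf, i, rfl⟩, hq⟩ := he
  have h2 := cls_src (S := T.essentialPart) (d := X.side f i) ⟨f, hf, i, rfl⟩
  exact ⟨f, ⟨hf, (cls_init_side (S := T.essentialPart) hf 0 i).trans (h2.symm.trans hq)⟩, i, rfl⟩

end Subcomplex

/-! ### Excess of the components of the essential part -/

namespace CombMap

variable {φ : CombMap X L} {hL : L.IsStandard} {K : L.Subcomplex} {y : L.E}
  {A : (L.fold hL K y).ZeroOneAngles}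

theorem mapsInto_component (q : Quot (φ.preimage K).essentialPart.Adj) :
    φ.MapsInto ((φ.preimage K).essentialPart.component q) K := by
  refine ⟨?_, ?_, fun f hf => hf.1⟩
  · rintro v ⟨⟨f, hf, i, rfl | rfl⟩, -⟩
    · exact (φ.preimage K).src_mem _ ((φ.preimage K).side_mem f hf i)
    · exact (φ.preimage K).tgt_mem _ ((φ.preimage K).side_mem f hf i)
  · rintro e ⟨⟨f, hf, i, rfl⟩, -⟩
    exact (φ.preimage K).side_mem f hf i

/-- The dart `d` belongs to the subcomplex `S`, and a 2-cell that is not mapped to `K` runs over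
its edge. -/
def IsBoundaryDart (φ : CombMap X L) (K : L.Subcomplex) (S : X.Subcomplex) (d : X.Dart) : Prop :=
  d.1 ∈ S.edges ∧ ∃ (c : φ.OuterCorner K) (b : Bool), X.linkStart (c.1, b) = d

theorem IsBoundaryDart.rev {S : X.Subcomplex} {d : X.Dart} (h : φ.IsBoundaryDart K S d) :
    φ.IsBoundaryDart K S (X.rev d) := by
  classical
  obtain ⟨h1, c, b, hc⟩ := h
  obtain ⟨i, hi⟩ := exists_side_of_linkStart hc
  exact ⟨h1, ⟨(X.sideLink (X.rev d) ⟨c.1.1, i⟩).1, by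
      unfold sideLink
      split_ifs <;> exact c.2⟩, (X.sideLink (X.rev d) ⟨c.1.1, i⟩).2,
    linkStart_sideLink (d := X.rev d) (c := ⟨c.1.1, i⟩) hi⟩

variable [Finite X.V] [Finite X.E] [Finite X.F]

/-- A component of the essential part with a height function and a boundary dart has total excess
at least two. -/
theorem two_le_sum_excess (hφ : φ.IsImmersion) (hfree : ∀ e, ¬ X.IsFreeEdge e)
    (hA : (L.fold hL K y).SatisfiesColoringTest A)
    (hnonneg : ∀ v, 0 ≤ φ.excess A v)
    {q : Quot (φ.preimage K).essentialPart.Adj} {h : X.V → ℤ}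
    (hh : φ.IsHeight ((φ.preimage K).essentialPart.component q) h) {d : X.Dart}
    (hd : φ.IsBoundaryDart K ((φ.preimage K).essentialPart.component q) d) :
    2 ≤ ∑ v ∈ ((φ.preimage K).essentialPart.component q).verts.toFinite.toFinset,
      φ.excess A v := by
  classical
  set C := (φ.preimage K).essentialPart.component q with hC
  set B : Set X.V := {v | ∃ d, φ.IsBoundaryDart K C d ∧ X.init d = v} with hB
  have hBne : B.Nonempty := ⟨_, d, hd, rfl⟩
  have hBC : B ⊆ C.verts := by
    rintro v ⟨d, hd, rfl⟩
    exact Subcomplex.init_mem hd.1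
  have key : ∀ v ∈ B, ∀ σ, (∀ d, φ.IsBoundaryDart K C d → X.init d = v → (φ.dart d).2 = σ) →
      1 ≤ φ.excess A v := by
    rintro v ⟨d, ⟨hd1, c0, b0, hd2⟩, rfl⟩ σ hσ
    have := zeroCorners_lt_outerDarts hφ hfree hA c0
      ((init_linkStart _ _).symm.trans (congrArg X.init hd2)) σ fun c hc b hcb => by
        refine hσ _ ⟨⟨hcb, ?_⟩, c, b, rfl⟩ ((init_linkStart _ _).trans hc)
        rw [Subcomplex.cls_src hcb, init_linkStart, hc, ← Subcomplex.cls_src hd1.1]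
        exact hd1.2
    unfold excess
    omega
  have hterm : ∀ d, φ.IsBoundaryDart K C d → X.term d ∈ B := fun d hd => ⟨X.rev d, hd.rev, rfl⟩
  obtain ⟨v, hv, hmin⟩ := B.toFinite.exists_minimalFor h B hBne
  obtain ⟨w, hw, hmax⟩ := B.toFinite.exists_maximalFor h B hBne
  have hle : ∀ x ∈ B, h v ≤ h x := fun x hx => by
    by_contra hlt
    exact hlt (hmin hx (by omega))
  have hge : ∀ x ∈ B, h x ≤ h w := fun x hx => by
    by_contra hlt
    exact hlt (hmax hx (by omega))
  -- At the lowest vertex of `B` a boundary dart against its edge would end lower, again in `B`. So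
  -- all boundary darts there fold to `y⁺`; at the highest vertex, to `y⁻`.
  have h1 : 1 ≤ φ.excess A v := key v hv true fun d hd hdv => by
    have h2 := hh d hd.1
    have h3 := hle _ (hterm d hd)
    rw [hdv] at h2
    by_contra hne
    rw [Bool.not_eq_true] at hne
    rw [hne] at h2
    simp only [sgn, Bool.false_eq_true, if_false] at h2
    omega
  have h2 : 1 ≤ φ.excess A w := key w hw false fun d hd hdv => by
    have h2 := hh d hd.1
    have h3 := hge _ (hterm d hd)
    rw [hdv] at h2
    by_contra hne
    rw [Bool.not_eq_false] at hne
    rw [hne] at h2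
    simp only [sgn, if_true] at h2
    omega
  -- If they coincided, the height would be constant on `B`, but it changes along `d`.
  have hvw : v ≠ w := by
    rintro rfl
    have h3 := hh d hd.1
    have h4 := hle _ (hterm d hd)
    have h5 := hge _ (hterm d hd)
    have h6 := hle _ ⟨d, hd, rfl⟩
    have h7 := hge _ ⟨d, hd, rfl⟩
    have h8 : sgn (φ.dart d).2 = 0 := by omega
    revert h8
    cases (φ.dart d).2 <;> simp [sgn]
  have hsub : ({v, w} : Finset X.V) ⊆ C.verts.toFinite.toFinset := by
    intro x hx
    rw [Finset.mem_insert, Finset.mem_singleton] at hx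
    rw [Set.Finite.mem_toFinset]
    rcases hx with rfl | rfl
    · exact hBC hv
    · exact hBC hw
  have h3 := Finset.sum_le_sum_of_subset_of_nonneg (f := φ.excess A) hsub fun v _ _ => hnonneg v
  rw [Finset.sum_pair hvw] at h3
  omega

theorem two_mul_eulerChar_component_le (hφ : φ.IsImmersion) (hfree : ∀ e, ¬ X.IsFreeEdge e)
    (hK : ∀ f ∈ K.faces, L.expSum f = 0) (hKN : K.toComplex.CollapsingNPI)
    (hA : (L.fold hL K y).SatisfiesColoringTest A) (hnonneg : ∀ v, 0 ≤ φ.excess A v)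
    (q : Quot (φ.preimage K).essentialPart.Adj) :
    2 * ((φ.preimage K).essentialPart.component q).toComplex.eulerChar ≤
      ∑ v ∈ ((φ.preimage K).essentialPart.component q).verts.toFinite.toFinset,
        φ.excess A v := by
  classical
  set C := (φ.preimage K).essentialPart.component q with hC
  have hsum : 0 ≤ ∑ v ∈ C.verts.toFinite.toFinset, φ.excess A v :=
    Finset.sum_nonneg fun v _ => hnonneg v
  rcases C.verts.eq_empty_or_nonempty with hemp | hne
  · have hE : C.edges = ∅ := Set.eq_empty_of_forall_notMem fun e he => by
      have := C.src_mem e he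
      simp [hemp] at this
    have hF : C.faces = ∅ := Set.eq_empty_of_forall_notMem fun f hf => by
      have := C.side_mem f hf 0
      simp [hE] at this
    rw [Subcomplex.eulerChar_toComplex, hemp, hE, hF]
    simp
  have hconn : C.IsConn := Subcomplex.isConn_component hne
  have hm : φ.MapsInto C K := mapsInto_component q
  rcases eulerChar_nonpos_or_exists_isHeight hφ hK hKN hm hconn with h0 | ⟨h1, h, hh⟩
  · linarith
  rw [h1]
  -- Every edge of `C` lies on a 2-cell of `C`, so there are no free vertices. Without free edges
  -- `C` would have `χ ≤ 0` or be a point, but it has `χ = 1` and a 2-cell.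
  have hfe : ∃ e, C.toComplex.IsFreeEdge e := by
    by_contra! hfe
    have hfv : ∀ v, ¬ C.toComplex.IsFreeVertex v := by
      rintro v ⟨⟨⟨e, he⟩, b⟩, -, hd⟩
      obtain ⟨f, hf, i, hi⟩ := Subcomplex.exists_face_of_edge_component he
      exact hd ⟨⟨f, hf⟩, i⟩ (Subtype.ext hi)
    rcases hKN C.toComplex (restrict hm) (hφ.restrict hm)
      ⟨inferInstanceAs (Finite C.verts), inferInstanceAs (Finite C.edges),
        inferInstanceAs (Finite C.faces)⟩ hconn.toComplex hfv hfe with h2 | h2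
    · omega
    · obtain ⟨v, hv⟩ := hne
      obtain ⟨f, hf, -⟩ := Subcomplex.exists_face_of_mem_component hv
      exact h2.2.2.2.false ⟨f, hf⟩
  obtain ⟨⟨e, he⟩, ⟨⟨f, hf⟩, i⟩, hi, hu⟩ := hfe
  have hi' : (X.side f i).1 = e := congrArg Subtype.val hi
  -- The edge is not free in `X`, so another side runs over it. A 2-cell over `K` there would belong
  -- to `C`; hence this side is outer and gives a boundary dart.
  have hex : ∃ c : X.Corner, (X.side c.1 c.2).1 = e ∧ c ≠ ⟨f, i⟩ := by
    by_contra! hno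
    exact hfree e ⟨⟨f, i⟩, hi', hno⟩
  obtain ⟨c, hc, hcne⟩ := hex
  have hcK : φ.face c.1 ∉ K.faces := by
    intro hcK
    have hcS : c.1 ∈ (φ.preimage K).essentialPart.faces := hcK
    have hcq : c.1 ∈ C.faces := by
      refine ⟨hcS, ?_⟩
      rw [Subcomplex.cls_init_side hcS 0 c.2, ←
        Subcomplex.cls_src ((φ.preimage K).essentialPart.side_mem _ hcS c.2), hc]
      exact he.2
    have h2 := hu ⟨⟨c.1, hcq⟩, c.2⟩ (Subtype.ext hc)
    exact hcne (congrArg (fun c : C.toComplex.Corner => (⟨c.1.1, c.2⟩ : X.Corner)) h2)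
  exact two_le_sum_excess hφ hfree hA hnonneg hh
    (d := X.linkStart (c, true)) ⟨by
      change (X.side c.1 c.2).1 ∈ _
      rw [hc]
      exact he, ⟨c, hcK⟩, true, rfl⟩

end CombMap

end TwoComplex

/-! ### The main theorem -/

theorem theorem3p5 (L : TwoComplex.{u}) (hL : L.IsStandard) (K : L.Subcomplex)
    (hK : ∀ f ∈ K.faces, L.expSum f = 0) (y : L.E) (hy : y ∈ K.edges)
    (A : (L.fold hL K y).ZeroOneAngles) (hA : (L.fold hL K y).SatisfiesColoringTest A)
    (hsep : ¬ (L.fold hL K y).SameComponentLk0 A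
      (⟨y, Or.inr rfl⟩, true) (⟨y, Or.inr rfl⟩, false)) :
    L.RelCollapsingNPI K ∧ (K.toComplex.CollapsingNPI → L.CollapsingNPI) := by
  have main : ∀ (X : TwoComplex.{u}) (φ : TwoComplex.CombMap X L), φ.IsImmersion → X.IsFinite →
      X.IsConnected → (∀ v, ¬ X.IsFreeVertex v) → (∀ e, ¬ X.IsFreeEdge e) → ¬ X.IsPoint →
      X.eulerChar ≤ (φ.preimage K).essentialPart.toComplex.eulerChar ∧
        (K.toComplex.CollapsingNPI → X.eulerChar ≤ 0) := by
    classical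
    rintro X φ hφ ⟨hV, hE, hF⟩ hX hfv hfe hp
    have := Fintype.ofFinite X.V
    have hnonneg : ∀ v, 0 ≤ φ.excess A v := fun v => by
      have := TwoComplex.CombMap.zeroCorners_le_outerDarts (φ := φ) hφ hA hsep v
      unfold TwoComplex.CombMap.excess
      omega
    have hGB := TwoComplex.CombMap.two_mul_eulerChar_add_le (φ := φ) hA fun v hv => by
      have := TwoComplex.CombMap.zeroCorners_add_two_le hφ hfe hfv hX hp hA hv
      unfold TwoComplex.CombMap.excess
      omega
    refine ⟨?_, fun hKN => ?_⟩
    · have := Finset.sum_nonneg (s := (φ.preimage K).essentialPart.verts.toFinite.toFinset)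
        fun v _ => hnonneg v
      linarith
    · have : Finite (Quot (φ.preimage K).essentialPart.Adj) :=
        Finite.of_surjective (Quot.mk _) Quot.mk_surjective
      have := Fintype.ofFinite (Quot (φ.preimage K).essentialPart.Adj)
      -- Splitting both sides over components lets each excess sum absorb twice the Euler
      -- characteristic of its component.
      rw [TwoComplex.Subcomplex.eulerChar_eq_sum_component,
        TwoComplex.Subcomplex.sum_verts_eq_sum_component, Finset.mul_sum] at hGB
      have := Finset.sum_le_sum fun q (_ : q ∈ Finset.univ) =>
        TwoComplex.CombMap.two_mul_eulerChar_component_le (φ := φ) hφ hfe hK hKN hA hnonneg q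
      linarith
  refine ⟨fun X φ h1 h2 h3 h4 h5 => ?_, fun hKN X φ h1 h2 h3 h4 h5 => ?_⟩
  · by_cases hp : X.IsPoint
    · exact Or.inr hp
    · exact Or.inl (main X φ h1 h2 h3 h4 h5 hp).1
  · by_cases hp : X.IsPoint
    · exact Or.inr hp
    · exact Or.inl ((main X φ h1 h2 h3 h4 h5 hp).2 hKN)
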